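/- For $n\ge 2$ let $B_n$ be the Euclidean unit ball of $\mathbb{R}^n$, let $\mu$ be the normalized Lebesgue measure on $B_n$, and let $W^{1,2}(\mu)$ be the space of real functions $f\in L^2(\mu)$ whose weak gradient $\nabla f$ in the interior of $B_n$ is square-integrable. Let $-\Delta$ be the Neumann Laplacian in $L^2(\mu)$, i.e. the self-adjoint operator associated with the Dirichlet form $\int \nabla f\cdot\nabla g\,d\mu$ with domain $W^{1,2}(\mu)$: $u$ belongs to its domain and $-\Delta u=w$ if and only if $u\in W^{1,2}(\mu)$, $w\in L^2(\mu)$ and $\int\nabla u\cdot\nabla\varphi\,d\mu=\int w\,\varphi\,d\mu$ for all $\varphi\in W^{1,2}(\mu)$. Then there is a largest real number $\lambda$ such that the spectrum of $-\Delta$ is contained in $\{0\}\cup[\lambda,+\infty)$, and this number, the Neumann spectral gap $\lambda_1(-\Delta)=\lambda_1(-\Delta;n)$, satisfies $$\frac{(n-1)(n+2)}{n}\;\le\;\lambda_1(-\Delta)\;\le\;n+2 .$$ In particular $\lambda_1(-\Delta)$ is of order $n$ as $n\to\infty$ (bounded above and below by positive constant multiples of $n$ for large $n$), and even $\lambda_1(-\Delta)/n\to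 1$. -/

import Mathlib

open MeasureTheory Set Filter Asymptotics
open scoped ContDiff RealInnerProductSpace

/-! ### Spectrum and spectral gap of an unbounded operator -/

section Spectral

variable {H : Type*} [NormedAddCommGroup H] [InnerProductSpace ℝ H]

/-- The (real) resolvent set of an unbounded operator `A` on `H`: the numbers `z` for which
`A - z`, as a map from the domain of `A` to `H`, has a bounded everywhere defined two-sided
inverse. -/
def unboundedResolventSet (A : H →ₗ.[ℝ] H) : Set ℝ :=
  {z | ∃ R : H →L[ℝ] H,
    (∀ y : H, ∃ hy : R y ∈ A.domain, A ⟨R y, hy⟩ - z • R y = y) ∧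
    ∀ x : A.domain, R (A x - z • (x : H)) = (x : H)}

/-- The spectrum of an unbounded operator: the complement of the resolvent set. -/
def unboundedSpectrum (A : H →ₗ.[ℝ] H) : Set ℝ := (unboundedResolventSet A)ᶜ

/-- The numbers `lam` such that the spectrum of `A` lies in `{0} ∪ [lam, ∞)`. -/
def gapSet (A : H →ₗ.[ℝ] H) : Set ℝ := {lam | unboundedSpectrum A ⊆ {0} ∪ Ici lam}

/-- The spectral gap of `A`: the largest real `lam` such that the spectrum of `A` lies in
`{0} ∪ [lam, ∞)`. -/
noncomputable def spectralGap (A : H →ₗ.[ℝ] H) : ℝ := sSup (gapSet A)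

end Spectral

/-! ### The Neumann Laplacian of the Euclidean unit ball -/

/-- The uniform probability measure on the Euclidean unit ball of `ℝⁿ`, that is, the normalized
restriction of Lebesgue measure. -/
noncomputable def uniformBall (n : ℕ) : Measure (EuclideanSpace ℝ (Fin n)) :=
  (volume (Metric.ball (0 : EuclideanSpace ℝ (Fin n)) 1))⁻¹ •
    volume.restrict (Metric.ball (0 : EuclideanSpace ℝ (Fin n)) 1)

/-- The space `L²(μ)` of real-valued functions, `μ` being the uniform measure on the unit ball. -/
abbrev BallL2 (n : ℕ) : Type := Lp ℝ 2 (uniformBall n)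

/-- The space of square-integrable vector fields on the unit ball. -/
abbrev BallL2Vec (n : ℕ) : Type := Lp (EuclideanSpace ℝ (Fin n)) 2 (uniformBall n)

/-- `G` is the weak (distributional) gradient of `f` in the open unit ball:
`∫ f ∂ᵥφ dμ = - ∫ (G · v) φ dμ` for all directions `v` and all smooth functions `φ` with compact
support in the open unit ball. Since `μ` has constant density in the ball, one may integrate with
respect to `μ` instead of Lebesgue measure. -/
def IsWeakGradient {n : ℕ} (f : EuclideanSpace ℝ (Fin n) → ℝ)
    (G : EuclideanSpace ℝ (Fin n) → EuclideanSpace ℝ (Fin n)) : Prop :=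
  ∀ φ : EuclideanSpace ℝ (Fin n) → ℝ, ContDiff ℝ ∞ φ → HasCompactSupport φ →
    tsupport φ ⊆ Metric.ball 0 1 → ∀ v : EuclideanSpace ℝ (Fin n),
      ∫ x, f x * fderiv ℝ φ x v ∂(uniformBall n) = - ∫ x, ⟪G x, v⟫ * φ x ∂(uniformBall n)

instance uniformBall_isProbabilityMeasure (n : ℕ) : IsProbabilityMeasure (uniformBall n) := by
  constructor
  have h0 : volume (Metric.ball (0 : EuclideanSpace ℝ (Fin n)) 1) ≠ 0 :=
    (Metric.measure_ball_pos _ _ one_pos).ne'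
  have h1 : volume (Metric.ball (0 : EuclideanSpace ℝ (Fin n)) 1) ≠ ⊤ := measure_ball_lt_top.ne
  simp [uniformBall, ENNReal.inv_mul_cancel h0 h1]

/-- Square-integrable functions may be multiplied with bounded continuous functions. -/
theorem integrable_mul_test {n : ℕ} {f g : EuclideanSpace ℝ (Fin n) → ℝ}
    (hf : MemLp f 2 (uniformBall n)) (hg : Continuous g) (hc : HasCompactSupport g) :
    Integrable (fun x => f x * g x) (uniformBall n) := by
  obtain ⟨C, hC⟩ := hc.exists_bound_of_continuous hg
  exact (hf.integrable one_le_two).mul_bdd (c := C) hg.aestronglyMeasurable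
    (Eventually.of_forall hC)

theorem memLp_inner_const {n : ℕ} {G : EuclideanSpace ℝ (Fin n) → EuclideanSpace ℝ (Fin n)}
    (hG : MemLp G 2 (uniformBall n)) (v : EuclideanSpace ℝ (Fin n)) :
    MemLp (fun x => ⟪G x, v⟫) 2 (uniformBall n) :=
  hG.inner_const v

/-- The Sobolev space `W^{1,2}(μ)`, as the space of all pairs `(f, ∇f)` where `f ∈ L²(μ)` has a
weak gradient `∇f` that belongs to `L²(μ)`. -/
def sobolevPairs (n : ℕ) : Submodule ℝ (BallL2 n × BallL2Vec n) where
  carrier := {p | IsWeakGradient (p.1 : EuclideanSpace ℝ (Fin n) → ℝ)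
    (p.2 : EuclideanSpace ℝ (Fin n) → EuclideanSpace ℝ (Fin n))}
  add_mem' := by
    rintro ⟨f, F⟩ ⟨g, G⟩ hf hg φ h1 h2 h3 v
    have hd : Continuous fun x => fderiv ℝ φ x v := (h1.continuous_fderiv (by simp)).clm_apply
      continuous_const
    have hdc : HasCompactSupport fun x => fderiv ℝ φ x v := h2.fderiv_apply ℝ v
    have e1 : ∫ x, ((f + g : BallL2 n) : _ → ℝ) x * fderiv ℝ φ x v ∂(uniformBall n)
        = ∫ x, (f x * fderiv ℝ φ x v + g x * fderiv ℝ φ x v) ∂(uniformBall n) := by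
      refine integral_congr_ae ?_
      filter_upwards [Lp.coeFn_add f g] with x hx
      rw [hx, Pi.add_apply, add_mul]
    have e2 : ∫ x, ⟪((F + G : BallL2Vec n) : _ → EuclideanSpace ℝ (Fin n)) x, v⟫ * φ x
        ∂(uniformBall n)
        = ∫ x, (⟪F x, v⟫ * φ x + ⟪G x, v⟫ * φ x) ∂(uniformBall n) := by
      refine integral_congr_ae ?_
      filter_upwards [Lp.coeFn_add F G] with x hx
      rw [hx, Pi.add_apply, inner_add_left, add_mul]
    have a := hf φ h1 h2 h3 v
    have b := hg φ h1 h2 h3 v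
    simp only [Prod.mk_add_mk] at a b ⊢
    rw [e1, e2, integral_add (integrable_mul_test (Lp.memLp f) hd hdc)
      (integrable_mul_test (Lp.memLp g) hd hdc),
      integral_add (integrable_mul_test (memLp_inner_const (Lp.memLp F) v) h1.continuous h2)
        (integrable_mul_test (memLp_inner_const (Lp.memLp G) v) h1.continuous h2), a, b]
    ring
  zero_mem' := by
    intro φ h1 h2 h3 v
    have e1 : ∫ x, ((0 : BallL2 n) : _ → ℝ) x * fderiv ℝ φ x v ∂(uniformBall n) = 0 := by
      refine integral_eq_zero_of_ae ?_
      filter_upwards [Lp.coeFn_zero ℝ 2 (uniformBall n)] with x hx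
      simp
    have e2 : ∫ x, ⟪((0 : BallL2Vec n) : _ → EuclideanSpace ℝ (Fin n)) x, v⟫ * φ x
        ∂(uniformBall n) = 0 := by
      refine integral_eq_zero_of_ae ?_
      filter_upwards [Lp.coeFn_zero (EuclideanSpace ℝ (Fin n)) 2 (uniformBall n)] with x hx
      simp
    simp only [Prod.fst_zero, Prod.snd_zero]
    rw [e1, e2, neg_zero]
  smul_mem' := by
    rintro c ⟨f, F⟩ hf φ h1 h2 h3 v
    have e1 : ∫ x, ((c • f : BallL2 n) : _ → ℝ) x * fderiv ℝ φ x v ∂(uniformBall n)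
        = ∫ x, c * (f x * fderiv ℝ φ x v) ∂(uniformBall n) := by
      refine integral_congr_ae ?_
      filter_upwards [Lp.coeFn_smul c f] with x hx
      rw [hx, Pi.smul_apply, smul_eq_mul, mul_assoc]
    have e2 : ∫ x, ⟪((c • F : BallL2Vec n) : _ → EuclideanSpace ℝ (Fin n)) x, v⟫ * φ x
        ∂(uniformBall n)
        = ∫ x, c * (⟪F x, v⟫ * φ x) ∂(uniformBall n) := by
      refine integral_congr_ae ?_
      filter_upwards [Lp.coeFn_smul c F] with x hx
      rw [hx, Pi.smul_apply, real_inner_smul_left, mul_assoc]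
    have a := hf φ h1 h2 h3 v
    simp only [Prod.smul_mk] at a ⊢
    rw [e1, e2, integral_const_mul, integral_const_mul, a]
    ring

/-- The graph of the Neumann operator `-Δ`: the pairs `(u, w)` such that `u ∈ W^{1,2}(μ)` and
`∫ ∇u · ∇φ dμ = ∫ w φ dμ` for all `φ ∈ W^{1,2}(μ)`. -/
def neumannGraph (n : ℕ) : Submodule ℝ (BallL2 n × BallL2 n) where
  carrier := {p | ∃ G : BallL2Vec n, (p.1, G) ∈ sobolevPairs n ∧
    ∀ q ∈ sobolevPairs n, ⟪G, q.2⟫ = ⟪p.2, q.1⟫}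
  add_mem' := by
    rintro ⟨u, w⟩ ⟨u', w'⟩ ⟨G, hG, h⟩ ⟨G', hG', h'⟩
    refine ⟨G + G', (sobolevPairs n).add_mem hG hG', fun q hq => ?_⟩
    simp only [Prod.mk_add_mk, inner_add_left]
    rw [h q hq, h' q hq]
  zero_mem' := ⟨0, (sobolevPairs n).zero_mem, fun q _ => by simp⟩
  smul_mem' := by
    rintro c ⟨u, w⟩ ⟨G, hG, h⟩
    refine ⟨c • G, (sobolevPairs n).smul_mem c hG, fun q hq => ?_⟩
    simp only [Prod.smul_mk, real_inner_smul_left]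
    rw [h q hq]

/-- Smooth functions with compact support in the open ball belong to `W^{1,2}(μ)`, their weak
gradient being the usual one. -/
theorem test_mem_sobolevPairs {n : ℕ} {φ : EuclideanSpace ℝ (Fin n) → ℝ} (h1 : ContDiff ℝ ∞ φ)
    (h2 : HasCompactSupport φ) :
    ∃ (hf : MemLp φ 2 (uniformBall n)) (hG : MemLp (gradient φ) 2 (uniformBall n)),
      (hf.toLp φ, hG.toLp (gradient φ)) ∈ sobolevPairs n := by
  have hφ : MemLp φ 2 (uniformBall n) := h1.continuous.memLp_of_hasCompactSupport h2
  have hfd : Continuous (fderiv ℝ φ) := h1.continuous_fderiv (by simp)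
  have hgc : Continuous (gradient φ) :=
    (InnerProductSpace.toDual ℝ (EuclideanSpace ℝ (Fin n))).symm.continuous.comp hfd
  have hgs : HasCompactSupport (gradient φ) :=
    (h2.fderiv ℝ).comp_left
      (g := (InnerProductSpace.toDual ℝ (EuclideanSpace ℝ (Fin n))).symm) (map_zero _)
  have hG : MemLp (gradient φ) 2 (uniformBall n) := hgc.memLp_of_hasCompactSupport hgs
  refine ⟨hφ, hG, ?_⟩
  intro ψ k1 k2 k3 v
  have hψd : Continuous fun x => fderiv ℝ ψ x v := (k1.continuous_fderiv (by simp)).clm_apply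
    continuous_const
  have hψs : HasCompactSupport fun x => fderiv ℝ ψ x v := k2.fderiv_apply ℝ v
  have hφd : Continuous fun x => fderiv ℝ φ x v := hfd.clm_apply continuous_const
  have e1 : ∫ x, (hφ.toLp φ : _ → ℝ) x * fderiv ℝ ψ x v ∂(uniformBall n)
      = ∫ x, φ x * fderiv ℝ ψ x v ∂(uniformBall n) := by
    refine integral_congr_ae ?_
    filter_upwards [hφ.coeFn_toLp] with x hx
    rw [hx]
  have e2 : ∫ x, ⟪(hG.toLp (gradient φ) : _ → EuclideanSpace ℝ (Fin n)) x, v⟫ * ψ x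
      ∂(uniformBall n) = ∫ x, fderiv ℝ φ x v * ψ x ∂(uniformBall n) := by
    refine integral_congr_ae ?_
    filter_upwards [hG.coeFn_toLp] with x hx
    rw [hx, gradient, InnerProductSpace.toDual_symm_apply]
  have r1 : ∫ x in Metric.ball 0 1, φ x * fderiv ℝ ψ x v = ∫ x, φ x * fderiv ℝ ψ x v := by
    refine setIntegral_eq_integral_of_forall_compl_eq_zero fun x hx => ?_
    have : x ∉ tsupport ψ := fun h => hx (k3 h)
    rw [show fderiv ℝ ψ x = 0 from image_eq_zero_of_notMem_tsupport
      (fun h => this (tsupport_fderiv_subset ℝ h))]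
    simp
  have r2 : ∫ x in Metric.ball 0 1, fderiv ℝ φ x v * ψ x = ∫ x, fderiv ℝ φ x v * ψ x := by
    refine setIntegral_eq_integral_of_forall_compl_eq_zero fun x hx => ?_
    rw [image_eq_zero_of_notMem_tsupport (fun h => hx (k3 h)), mul_zero]
  simp only
  rw [e1, e2, uniformBall, integral_smul_measure, integral_smul_measure, r1, r2,
    integral_mul_fderiv_eq_neg_fderiv_mul_of_integrable, smul_neg]
  · exact (hφd.mul k1.continuous).integrable_of_hasCompactSupport (k2.mul_left)
  · exact (h1.continuous.mul hψd).integrable_of_hasCompactSupport (hψs.mul_left)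
  · exact (h1.continuous.mul k1.continuous).integrable_of_hasCompactSupport (k2.mul_left)
  · exact fun x _ => (h1.differentiable (by simp)).differentiableAt
  · exact fun x _ => (k1.differentiable (by simp)).differentiableAt

/-- The Neumann operator is single-valued. -/
theorem neumannGraph_singleValued (n : ℕ) :
    ∀ p : BallL2 n × BallL2 n, p ∈ neumannGraph n → p.1 = 0 → p.2 = 0 := by
  rintro ⟨u, w⟩ ⟨G, hG, h⟩ hu
  simp only at hG h hu ⊢
  subst hu
  have hG0 : G = 0 := by
    have := h _ hG
    simpa using this
  subst hG0
  have hb : ∀ᵐ x ∂(uniformBall n), x ∈ Metric.ball (0 : EuclideanSpace ℝ (Fin n)) 1 :=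
    Measure.ae_smul_measure (ae_restrict_mem measurableSet_ball) _
  have hw : ∀ᵐ x ∂(uniformBall n), x ∈ Metric.ball (0 : EuclideanSpace ℝ (Fin n)) 1 → w x = 0 := by
    refine Metric.isOpen_ball.ae_eq_zero_of_integral_contDiff_smul_eq_zero
      (((Lp.memLp w).integrable one_le_two).locallyIntegrable.locallyIntegrableOn _) ?_
    intro φ h1 h2 _
    obtain ⟨hf, hg, hm⟩ := test_mem_sobolevPairs (n := n) h1 h2
    have h0 := h _ hm
    rw [inner_zero_left, L2.inner_def] at h0
    rw [h0]
    refine integral_congr_ae ?_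
    filter_upwards [hf.coeFn_toLp] with x hx
    simp [hx]
  rw [Lp.eq_zero_iff_ae_eq_zero]
  filter_upwards [hb, hw] with x h1 h2 using h2 h1

/-- The Neumann Laplacian `-Δ` of the unit ball, as an unbounded operator on `L²(μ)`: the operator
associated with the Dirichlet form `∫ ∇f · ∇g dμ` with domain `W^{1,2}(μ)`. -/
noncomputable def neumannLaplacian (n : ℕ) : BallL2 n →ₗ.[ℝ] BallL2 n :=
  (neumannGraph n).toLinearPMap

/-- Description of the operator: `u` lies in the domain and `-Δ u = w` if and only if `u` and `w`
satisfy the weak formulation of the Neumann problem. -/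
theorem mem_graph_neumannLaplacian (n : ℕ) (u w : BallL2 n) :
    (u, w) ∈ (neumannLaplacian n).graph ↔ ∃ G : BallL2Vec n, (u, G) ∈ sobolevPairs n ∧
      ∀ q ∈ sobolevPairs n, ⟪G, q.2⟫ = ⟪w, q.1⟫ := by
  rw [neumannLaplacian, Submodule.toLinearPMap_graph_eq _ (neumannGraph_singleValued n)]
  rfl

/-! The spectral gap is the infimum of the Rayleigh quotient over mean-zero functions, so it
suffices to bound that infimum. The abstract part proves this variational principle for any closed
form whose gradient kills a unit vector `e`, without compactness and without a minimizer: nonzero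
points below the infimum are resolved by Lax–Milgram on the complement of `e`, and the infimum lies
in the spectrum because a bounded resolvent there would improve an almost optimal test function.

For the lower bound, the Dirichlet form is compared with that of the Legendre operator `L = -div((1
- x xᵀ)∇)`. In the ball `0 ≤ 1 - x xᵀ ≤ 1`, so the Legendre energy is the smaller one. Its
coefficient degenerates in the normal direction at the sphere, hence Green's formula against
polynomials holds for every Sobolev function without a boundary term
(`integral_inner_legendreField`). On polynomials `L` is symmetric, and modulo lower degree it
multiplies degree `d` by `d(d + n)`; this gives the gap `n + 1` (`legendreOp_gap`). Density of
polynomials in `L²` carries the bound over to the Sobolev space (`poincareOn_sobolevPairs`), and `n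
+ 1` exceeds `(n - 1)(n + 2)/n = n + 1 - 2/n`.

For the upper bound, a coordinate function has mean zero, gradient of norm one and squared norm
`1/(n + 2)`. -/

/-! ### Spectral gaps of operators associated with closed forms -/

section FormOperator

variable {H K : Type*} [NormedAddCommGroup H] [InnerProductSpace ℝ H]
  [NormedAddCommGroup K] [InnerProductSpace ℝ K]

/-- `A` is the operator associated with the form `(u, G), (v, F) ↦ ⟪G, F⟫` on `S`, the space `S`
being thought of as the graph of a gradient. -/
def IsFormOperator (S : Submodule ℝ (H × K)) (A : H →ₗ.[ℝ] H) : Prop :=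
  ∀ u w : H, (u, w) ∈ A.graph ↔ ∃ G : K, (u, G) ∈ S ∧ ∀ q ∈ S, ⟪G, q.2⟫ = ⟪w, q.1⟫

/-- The Poincaré inequality with constant `ν` on the orthogonal complement of `e`. -/
def PoincareOn (S : Submodule ℝ (H × K)) (e : H) (ν : ℝ) : Prop :=
  ∀ p ∈ S, ⟪e, p.1⟫ = 0 → ν * ‖p.1‖ ^ 2 ≤ ‖p.2‖ ^ 2

variable {S : Submodule ℝ (H × K)} {A : H →ₗ.[ℝ] H} {e : H} {ν : ℝ}

/-- Lax–Milgram for the shifted form on the orthogonal complement of `e`. -/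
theorem PoincareOn.exists_solution [CompleteSpace H] [CompleteSpace K]
    (hS : IsClosed (S : Set (H × K))) (hν : 0 < ν) (hP : PoincareOn S e ν) {z : ℝ} (hz : z < ν) :
    ∃ R : H →L[ℝ] H, ∀ y : H, ⟪e, R y⟫ = 0 ∧ ∃ G : K, (R y, G) ∈ S ∧
      ∀ q ∈ S, ⟪e, q.1⟫ = 0 → ⟪G, q.2⟫ - z * ⟪R y, q.1⟫ = ⟪y, q.1⟫ := by
  -- The `L²` product norm makes the form domain a Hilbert space under the graph norm.
  let V : Submodule ℝ (WithLp 2 (H × K)) :=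
    S.comap (WithLp.linearEquiv 2 ℝ (H × K)).toLinearMap ⊓
      (innerSL ℝ e ∘L WithLp.fstL 2 ℝ H K).toLinearMap.ker
  have hmem : ∀ p : WithLp 2 (H × K), p ∈ V ↔ (p.fst, p.snd) ∈ S ∧ ⟪e, p.fst⟫ = 0 :=
    fun p => Iff.rfl
  have hVc : IsClosed (V : Set (WithLp 2 (H × K))) := by
    have h1 : IsClosed {p : WithLp 2 (H × K) | (p.fst, p.snd) ∈ S} :=
      hS.preimage (WithLp.prod_continuous_ofLp 2 H K)
    have h2 : IsClosed {p : WithLp 2 (H × K) | ⟪e, p.fst⟫ = 0} :=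
      isClosed_eq (innerSL ℝ e ∘L WithLp.fstL 2 ℝ H K).continuous continuous_const
    exact h1.inter h2
  have : CompleteSpace V := hVc.completeSpace_coe
  let f : V →L[ℝ] H := WithLp.fstL 2 ℝ H K ∘L V.subtypeL
  let g : V →L[ℝ] K := WithLp.sndL 2 ℝ H K ∘L V.subtypeL
  let B : V →L[ℝ] V →L[ℝ] ℝ :=
    (innerSL ℝ).bilinearComp g g - z • (innerSL ℝ).bilinearComp f f
  have hB : ∀ v w : V, B v w = ⟪g v, g w⟫ - z * ⟪f v, f w⟫ := fun v w => rfl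
  have hnorm : ∀ v : V, ‖v‖ ^ 2 = ‖f v‖ ^ 2 + ‖g v‖ ^ 2 := fun v =>
    WithLp.prod_norm_sq_eq_of_L2 (v : WithLp 2 (H × K))
  have hco : IsCoercive B := by
    -- Keep the fraction `t` of the gradient term and spend the rest through Poincaré. The second
    -- bound on `t` leaves `(1 - t)ν - z ≥ (ν - z)/2`; the first keeps `1 - t` nonnegative when `z`
    -- is very negative.
    set t : ℝ := min (1 / 2) ((ν - z) / (2 * ν)) with ht
    have ht0 : 0 < t := lt_min (by norm_num) (div_pos (by linarith) (by linarith))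
    have ht1 : t ≤ 1 / 2 := min_le_left _ _
    have ht2 : t * (2 * ν) ≤ ν - z := by
      rw [← le_div_iff₀ (by linarith)]; exact min_le_right _ _
    have hc : 0 < (1 - t) * ν - z := by nlinarith
    refine ⟨min t ((1 - t) * ν - z), lt_min ht0 hc, fun v => ?_⟩
    have hv := hP _ ((hmem _).1 v.2).1 ((hmem _).1 v.2).2
    change ν * ‖f v‖ ^ 2 ≤ ‖g v‖ ^ 2 at hv
    rw [hB, real_inner_self_eq_norm_sq, real_inner_self_eq_norm_sq, mul_assoc, ← sq, hnorm]
    have m1 := mul_le_mul_of_nonneg_right (min_le_left t ((1 - t) * ν - z)) (sq_nonneg ‖g v‖)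
    have m2 := mul_le_mul_of_nonneg_right (min_le_right t ((1 - t) * ν - z)) (sq_nonneg ‖f v‖)
    nlinarith
  refine ⟨f ∘L (hco.continuousLinearEquivOfBilin.symm : V →L[ℝ] V) ∘L
    ContinuousLinearMap.adjoint f, fun y => ?_⟩
  set v : V := hco.continuousLinearEquivOfBilin.symm (ContinuousLinearMap.adjoint f y) with hvdef
  refine ⟨((hmem _).1 v.2).2, g v, ((hmem _).1 v.2).1, fun q hq hq0 => ?_⟩
  let w : V := ⟨WithLp.toLp 2 q, (hmem _).2 ⟨hq, hq0⟩⟩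
  have h := hco.continuousLinearEquivOfBilin_apply v w
  rw [hvdef, ContinuousLinearEquiv.apply_symm_apply, ContinuousLinearMap.adjoint_inner_left,
    ← hvdef, hB] at h
  exact h.symm

/-- Below the Poincaré constant, only `0` can lie in the spectrum. -/
theorem IsFormOperator.mem_resolventSet [CompleteSpace H] [CompleteSpace K]
    (hA : IsFormOperator S A) (hS : IsClosed (S : Set (H × K))) (he : ‖e‖ = 1)
    (heS : (e, (0 : K)) ∈ S) (hν : 0 < ν) (hP : PoincareOn S e ν) {z : ℝ} (hz : z < ν)
    (hz0 : z ≠ 0) : z ∈ unboundedResolventSet A := by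
  obtain ⟨R, hR⟩ := hP.exists_solution hS hν hz
  have hee : ⟪e, e⟫ = 1 := by rw [real_inner_self_eq_norm_sq, he, one_pow]
  have hAe : (e, (0 : H)) ∈ A.graph := (hA _ _).2 ⟨0, heS, by simp⟩
  have hAR : ∀ y, (R y, y + z • R y - ⟪e, y⟫ • e) ∈ A.graph := by
    intro y
    obtain ⟨h0, G, hG, h⟩ := hR y
    refine (hA _ _).2 ⟨G, hG, fun q hq => ?_⟩
    -- Removing the `e` component makes `q` admissible for the solution property and leaves its
    -- gradient unchanged.
    have hq' : q - ⟪e, q.1⟫ • (e, (0 : K)) ∈ S := S.sub_mem hq (S.smul_mem _ heS)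
    have h1 := h _ hq' (by simp [inner_sub_right, inner_smul_right, he])
    simp only [Prod.fst_sub, Prod.snd_sub, Prod.smul_mk, smul_zero, sub_zero, inner_sub_right,
      inner_smul_right, real_inner_comm e (R y), h0] at h1
    simp only [inner_add_left, inner_sub_left, real_inner_smul_left]
    rw [real_inner_comm e y] at *
    linarith
  -- An eigenvector for `z ≠ 0` is orthogonal to `e`, and then the Poincaré inequality contradicts
  -- `z < ν`.
  have hinj : ∀ x, (x, z • x) ∈ A.graph → x = 0 := by
    intro x hx
    obtain ⟨G, hG, h⟩ := (hA _ _).1 hx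
    have h1 := h _ heS
    have h2 := h _ hG
    simp only [inner_zero_right, real_inner_smul_left, real_inner_self_eq_norm_sq] at h1 h2
    have h3 : ⟪e, x⟫ = 0 := by
      rw [real_inner_comm]; exact (mul_eq_zero.1 h1.symm).resolve_left hz0
    have h4 := hP _ hG h3
    simp only at h4
    have h5 : ‖x‖ ^ 2 = 0 := by nlinarith [sq_nonneg ‖x‖]
    simpa using h5
  have hgr : ∀ y, (R y - (z⁻¹ * ⟪e, y⟫) • e, y + z • (R y - (z⁻¹ * ⟪e, y⟫) • e)) ∈ A.graph := by
    intro y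
    have h := A.graph.sub_mem (hAR y) (A.graph.smul_mem (z⁻¹ * ⟪e, y⟫) hAe)
    convert h using 2
    · simp
    · simp [smul_sub, smul_smul, hz0, add_sub_assoc]
  -- Since `A e = 0`, the resolvent multiplies `e` by `-z⁻¹`.
  refine ⟨R - z⁻¹ • (innerSL ℝ e).smulRight e, fun y => ?_, fun x => ?_⟩
  · obtain ⟨x, hx1, hx2⟩ := (LinearPMap.mem_graph_iff _).1 (hgr y)
    have hRy : (R - z⁻¹ • (innerSL ℝ e).smulRight e) y = R y - (z⁻¹ * ⟪e, y⟫) • e := by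
      simp [smul_smul]
    simp only at hx1 hx2
    rw [hRy]
    refine ⟨hx1 ▸ x.2, ?_⟩
    have : (⟨_, hx1 ▸ x.2⟩ : A.domain) = x := Subtype.ext hx1.symm
    rw [this, hx2]
    simp
  · have hRy : (R - z⁻¹ • (innerSL ℝ e).smulRight e) (A x - z • (x : H)) =
        R (A x - z • (x : H)) - (z⁻¹ * ⟪e, A x - z • (x : H)⟫) • e := by
      simp [smul_smul]
    rw [hRy]
    have h := A.graph.sub_mem (hgr (A x - z • (x : H))) (A.mem_graph x)
    refine sub_eq_zero.1 (hinj _ ?_)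
    convert h using 2
    · rfl
    · simp only [Prod.snd_sub, smul_sub]
      abel

/-- An optimal Poincaré constant lies in the spectrum. -/
theorem IsFormOperator.mem_spectrum (hA : IsFormOperator S A) (heS : (e, (0 : K)) ∈ S)
    (hν : 0 < ν) (hP : PoincareOn S e ν)
    (hopt : ∀ ε > 0, ∃ p ∈ S, ⟪e, p.1⟫ = 0 ∧ ‖p.1‖ = 1 ∧ ‖p.2‖ ^ 2 < ν + ε) :
    ν ∈ unboundedSpectrum A := by
  rintro ⟨R, hR, -⟩
  have hpos : 0 < ‖R‖ + 1 := by positivity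
  -- The tolerance equals the step size `t` used below for the perturbation `p - t(r, G)`.
  obtain ⟨p, hp, hep, hp1, hp2⟩ := hopt (1 / (‖R‖ + 1)) (by positivity)
  obtain ⟨hy, hAy⟩ := hR p.1
  set r := R p.1 with hr
  have hgr : (r, p.1 + ν • r) ∈ A.graph := by
    have := A.mem_graph ⟨r, hy⟩
    rwa [sub_eq_iff_eq_add.1 hAy] at this
  obtain ⟨G, hG, h⟩ := (hA _ _).1 hgr
  have h1 := h _ heS
  have h2 := h _ hG
  have h3 := h _ hp
  simp only [inner_zero_right, inner_add_left, real_inner_smul_left, real_inner_self_eq_norm_sq,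
    hp1] at h1 h2 h3
  have her : ⟪e, r⟫ = 0 := by
    rw [real_inner_comm p.1 e] at hep
    rw [hep, zero_add] at h1
    rw [real_inner_comm]
    exact (mul_eq_zero.1 h1.symm).resolve_left hν.ne'
  have hpr : ⟪p.1, r⟫ ≤ ‖R‖ := by
    calc ⟪p.1, r⟫ ≤ ‖p.1‖ * ‖r‖ := real_inner_le_norm _ _
      _ ≤ 1 * (‖R‖ * 1) := by
        rw [hp1]; gcongr; simpa [hp1] using R.le_opNorm p.1
      _ = ‖R‖ := by ring
  set t := 1 / (‖R‖ + 1) with ht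
  have htR : t * (‖R‖ + 1) = 1 := by rw [ht]; field_simp
  have ht0 : 0 < t := by positivity
  -- After the terms in `ν` cancel, this reads `ν ≤ ‖p.2‖² - 2t + t²⟪p.1, r⟫`. With `‖p.2‖² < ν + t`
  -- and `t²‖R‖ = t - t²` the right side is below `ν - t²`, a contradiction.
  have hq := hP _ (S.sub_mem hp (S.smul_mem t hG)) (by
    simp [inner_sub_right, inner_smul_right, hep, her])
  simp only [Prod.fst_sub, Prod.snd_sub, Prod.smul_mk, norm_sub_sq_real, inner_smul_right,
    norm_smul, mul_pow, hp1, Real.norm_eq_abs, sq_abs] at hq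
  rw [real_inner_comm] at h3
  rw [real_inner_comm p.1 r] at h3
  nlinarith [mul_le_mul_of_nonneg_left hpr (sq_nonneg t)]

/-- The variational principle for the spectral gap of the operator associated with a closed
form. -/
theorem IsFormOperator.isGreatest_gapSet [CompleteSpace H] [CompleteSpace K]
    (hA : IsFormOperator S A) (hS : IsClosed (S : Set (H × K))) (he : ‖e‖ = 1)
    (heS : (e, (0 : K)) ∈ S) {lam : ℝ} (hlam : 0 < lam) (hP : PoincareOn S e lam)
    {p : H × K} (hp : p ∈ S) (hep : ⟪e, p.1⟫ = 0) (hp0 : p.1 ≠ 0) :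
    IsGreatest (gapSet A) (spectralGap A) ∧ lam ≤ spectralGap A ∧
      spectralGap A * ‖p.1‖ ^ 2 ≤ ‖p.2‖ ^ 2 := by
  -- The Rayleigh quotients. The given `p` makes this set nonempty and `lam` bounds it below, so its
  -- `sInf` is a genuine infimum.
  let Q : Set ℝ := {s | ∃ q ∈ S, ⟪e, q.1⟫ = 0 ∧ ‖q.1‖ = 1 ∧ ‖q.2‖ ^ 2 = s}
  have hscale : ∀ q ∈ S, ⟪e, q.1⟫ = 0 → q.1 ≠ 0 → ‖q.2‖ ^ 2 / ‖q.1‖ ^ 2 ∈ Q := by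
    intro q hq heq hq0
    refine ⟨‖q.1‖⁻¹ • q, S.smul_mem _ hq, ?_, ?_, ?_⟩
    · simp [inner_smul_right, heq]
    · simp [norm_smul, hq0]
    · simp only [Prod.smul_snd, norm_smul, norm_inv, norm_norm]
      field_simp
  have hlow : lam ∈ lowerBounds Q := by
    rintro s ⟨q, hq, heq, hq1, rfl⟩
    simpa [hq1] using hP q hq heq
  have hne : Q.Nonempty := ⟨_, hscale p hp hep hp0⟩
  set ν := sInf Q with hνdef
  have hlν : lam ≤ ν := le_csInf hne hlow
  have hν : 0 < ν := hlam.trans_le hlν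
  have hPν : PoincareOn S e ν := by
    intro q hq heq
    by_cases hq0 : q.1 = 0
    · simp [hq0]
    · have hpos : 0 < ‖q.1‖ ^ 2 := by positivity
      exact (le_div_iff₀ hpos).1 (csInf_le ⟨lam, hlow⟩ (hscale q hq heq hq0))
  have hgreat : IsGreatest (gapSet A) ν := by
    constructor
    · intro z hz
      by_contra hcon
      simp only [mem_union, mem_singleton_iff, mem_Ici, not_or, not_le] at hcon
      exact hz (hA.mem_resolventSet hS he heS hν hPν hcon.2 hcon.1)
    · intro l hl
      have hspec : ν ∈ unboundedSpectrum A := by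
        refine hA.mem_spectrum heS hν hPν fun ε hε => ?_
        obtain ⟨s, ⟨q, hq, heq, hq1, rfl⟩, hs⟩ := exists_lt_of_csInf_lt hne
          (show sInf Q < ν + ε by linarith)
        exact ⟨q, hq, heq, hq1, hs⟩
      rcases hl hspec with h | h
      · exact absurd h hν.ne'
      · exact h
  have hgap : spectralGap A = ν := hgreat.csSup_eq
  rw [hgap]
  exact ⟨hgreat, hlν, hPν p hp hep⟩

end FormOperator

/-! ### The Sobolev space of the ball is closed -/

theorem ae_mem_ball_uniformBall (n : ℕ) :
    ∀ᵐ x ∂(uniformBall n), x ∈ Metric.ball (0 : EuclideanSpace ℝ (Fin n)) 1 :=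
  Measure.ae_smul_measure (ae_restrict_mem measurableSet_ball) _

/-- For a fixed test function and direction, both sides of the defining identity are `L²` inner
products with fixed elements, hence continuous. -/
theorem isClosed_sobolevPairs (n : ℕ) :
    IsClosed (sobolevPairs n : Set (BallL2 n × BallL2Vec n)) := by
  have : (sobolevPairs n : Set (BallL2 n × BallL2Vec n)) =
      ⋂ (φ : EuclideanSpace ℝ (Fin n) → ℝ) (_ : ContDiff ℝ ∞ φ) (_ : HasCompactSupport φ)
        (_ : tsupport φ ⊆ Metric.ball 0 1) (v : EuclideanSpace ℝ (Fin n)),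
        {p | ∫ x, p.1 x * fderiv ℝ φ x v ∂(uniformBall n)
          = - ∫ x, ⟪p.2 x, v⟫ * φ x ∂(uniformBall n)} := by
    ext p
    simp only [mem_iInter, mem_ofPred_eq]
    exact Iff.rfl
  rw [this]
  refine isClosed_iInter fun φ => isClosed_iInter fun h1 => isClosed_iInter fun h2 =>
    isClosed_iInter fun _ => isClosed_iInter fun v => ?_
  have hd : MemLp (fun x => fderiv ℝ φ x v) 2 (uniformBall n) :=
    Continuous.memLp_of_hasCompactSupport
      ((h1.continuous_fderiv (by simp)).clm_apply continuous_const) (h2.fderiv_apply ℝ v)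
  have hφ : MemLp (fun x => φ x • v) 2 (uniformBall n) :=
    (h1.continuous.smul continuous_const).memLp_of_hasCompactSupport h2.smul_right
  have e1 : ∀ f : BallL2 n, ∫ x, f x * fderiv ℝ φ x v ∂(uniformBall n) = ⟪f, hd.toLp _⟫ := by
    intro f
    rw [L2.inner_def]
    refine integral_congr_ae ?_
    filter_upwards [hd.coeFn_toLp] with x hx
    rw [hx]
    simp [mul_comm]
  have e2 : ∀ G : BallL2Vec n, ∫ x, ⟪G x, v⟫ * φ x ∂(uniformBall n) = ⟪G, hφ.toLp _⟫ := by
    intro G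
    rw [L2.inner_def]
    refine integral_congr_ae ?_
    filter_upwards [hφ.coeFn_toLp] with x hx
    rw [hx, inner_smul_right, mul_comm]
  simp only [e1, e2]
  exact isClosed_eq (continuous_fst.inner continuous_const)
    (continuous_snd.inner continuous_const).neg

/-! ### Polynomial functions on Euclidean space -/

section Polynomial

open MvPolynomial

variable {n : ℕ}

/-- The function on Euclidean space defined by a polynomial. -/
noncomputable def polyFun (p : MvPolynomial (Fin n) ℝ) (x : EuclideanSpace ℝ (Fin n)) : ℝ :=
  eval x.ofLp p

/-- The vector field defined by a family of polynomials. -/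
noncomputable def polyField (P : Fin n → MvPolynomial (Fin n) ℝ) (x : EuclideanSpace ℝ (Fin n)) :
    EuclideanSpace ℝ (Fin n) :=
  WithLp.toLp 2 fun i => polyFun (P i) x

@[simp] theorem polyField_apply (P : Fin n → MvPolynomial (Fin n) ℝ)
    (x : EuclideanSpace ℝ (Fin n)) (i : Fin n) : polyField P x i = polyFun (P i) x := rfl

theorem inner_polyField (P : Fin n → MvPolynomial (Fin n) ℝ) (x v : EuclideanSpace ℝ (Fin n)) :
    ⟪v, polyField P x⟫ = ∑ i, v i * polyFun (P i) x := by
  simp [PiLp.inner_apply, mul_comm]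

theorem contDiff_polyFun (p : MvPolynomial (Fin n) ℝ) : ContDiff ℝ ∞ (polyFun p) := by
  induction p using MvPolynomial.induction_on with
  | C a =>
    have h : polyFun (C a : MvPolynomial (Fin n) ℝ) = fun _ => a := by ext; simp [polyFun]
    rw [h]; exact contDiff_const
  | add p q hp hq =>
    have h : polyFun (p + q) = polyFun p + polyFun q := by ext; simp [polyFun]
    rw [h]; exact hp.add hq
  | mul_X p i hp =>
    have hi : ContDiff ℝ ∞ fun x : EuclideanSpace ℝ (Fin n) => x i := by fun_prop
    have := hp.mul hi
    have h : polyFun (p * X i) = fun x => polyFun p x * x i := by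
      ext x; simp [polyFun]
    rw [h]; exact this

theorem continuous_polyFun (p : MvPolynomial (Fin n) ℝ) : Continuous (polyFun p) :=
  (contDiff_polyFun p).continuous

theorem continuous_polyField (P : Fin n → MvPolynomial (Fin n) ℝ) : Continuous (polyField P) :=
  (PiLp.continuous_toLp 2 _).comp (continuous_pi fun i => continuous_polyFun (P i))

theorem hasFDerivAt_polyFun (p : MvPolynomial (Fin n) ℝ) (x : EuclideanSpace ℝ (Fin n)) :
    HasFDerivAt (polyFun p) (innerSL ℝ (polyField (fun i => pderiv i p) x)) x := by
  induction p using MvPolynomial.induction_on with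
  | C a =>
    have h : polyFun (C a : MvPolynomial (Fin n) ℝ) = fun _ => a := by ext; simp [polyFun]
    rw [h]
    refine (hasFDerivAt_const a x).congr_fderiv ?_
    ext v
    rw [innerSL_apply_apply, real_inner_comm, inner_polyField]
    simp [polyFun]
  | add p q hp hq =>
    have h : polyFun (p + q) = polyFun p + polyFun q := by ext; simp [polyFun]
    rw [h]
    refine (hp.add hq).congr_fderiv ?_
    ext v
    rw [_root_.add_apply]
    simp only [innerSL_apply_apply, real_inner_comm v, inner_polyField, ← Finset.sum_add_distrib]
    simp [polyFun, mul_add]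
  | mul_X p i hp =>
    have hi : HasFDerivAt (fun x : EuclideanSpace ℝ (Fin n) => x i)
      (EuclideanSpace.proj i : EuclideanSpace ℝ (Fin n) →L[ℝ] ℝ) x :=
      (EuclideanSpace.proj i : EuclideanSpace ℝ (Fin n) →L[ℝ] ℝ).hasFDerivAt
    have h : polyFun (p * X i) = fun x => polyFun p x * x i := by
      ext x; simp [polyFun]
    rw [h]
    refine (hp.mul hi).congr_fderiv ?_
    ext v
    rw [_root_.add_apply]
    simp only [_root_.smul_apply, innerSL_apply_apply, real_inner_comm v, inner_polyField, smul_eq_mul, Finset.mul_sum]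
    have : ∀ j, v j * polyFun (pderiv j (p * X i)) x =
        (if j = i then polyFun p x * v i else 0) + x i * (v j * polyFun (pderiv j p) x) := by
      intro j
      rw [pderiv_mul, pderiv_X]
      by_cases hj : j = i
      · subst hj; simp [polyFun]; ring
      · simp [polyFun, hj, Ne.symm hj]; ring
    rw [Finset.sum_congr rfl fun j _ => this j, Finset.sum_add_distrib]
    simp

theorem fderiv_polyFun (p : MvPolynomial (Fin n) ℝ) (x v : EuclideanSpace ℝ (Fin n)) :
    fderiv ℝ (polyFun p) x v = ⟪v, polyField (fun i => pderiv i p) x⟫ := by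
  rw [(hasFDerivAt_polyFun p x).fderiv, innerSL_apply_apply, real_inner_comm]

theorem gradient_polyFun (p : MvPolynomial (Fin n) ℝ) :
    gradient (polyFun p) = polyField fun i => pderiv i p := by
  ext1 x
  refine ext_inner_left ℝ fun v => ?_
  rw [← fderiv_polyFun, real_inner_comm, gradient, InnerProductSpace.toDual_symm_apply]

theorem exists_bound_ball_of_continuous {F : Type*} [NormedAddCommGroup F]
    {g : EuclideanSpace ℝ (Fin n) → F} (hg : Continuous g) :
    ∃ C, ∀ x ∈ Metric.ball (0 : EuclideanSpace ℝ (Fin n)) 1, ‖g x‖ ≤ C := by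
  obtain ⟨C, hC⟩ := (isCompact_closedBall (0 : EuclideanSpace ℝ (Fin n)) 1).exists_bound_of_continuousOn
    hg.continuousOn
  exact ⟨C, fun x hx => hC x (Metric.ball_subset_closedBall hx)⟩

theorem Continuous.memLp_uniformBall {F : Type*} [NormedAddCommGroup F]
    [SecondCountableTopologyEither (EuclideanSpace ℝ (Fin n)) F]
    {g : EuclideanSpace ℝ (Fin n) → F} (hg : Continuous g) : MemLp g 2 (uniformBall n) := by
  obtain ⟨C, hC⟩ := exists_bound_ball_of_continuous hg
  exact MemLp.of_bound hg.aestronglyMeasurable C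
    ((ae_mem_ball_uniformBall n).mono fun x hx => hC x hx)

theorem memLp_polyFun (p : MvPolynomial (Fin n) ℝ) : MemLp (polyFun p) 2 (uniformBall n) :=
  (continuous_polyFun p).memLp_uniformBall

theorem memLp_polyField (P : Fin n → MvPolynomial (Fin n) ℝ) :
    MemLp (polyField P) 2 (uniformBall n) :=
  (continuous_polyField P).memLp_uniformBall

/-- The class of a polynomial in `L²` of the ball. -/
noncomputable def polyL2 : MvPolynomial (Fin n) ℝ →ₗ[ℝ] BallL2 n where
  toFun p := (memLp_polyFun p).toLp _
  map_add' p q := by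
    rw [← MemLp.toLp_add]
    congr 1; ext x; simp [polyFun]
  map_smul' c p := by
    rw [RingHom.id_apply, ← MemLp.toLp_const_smul]
    congr 1; ext x; simp [polyFun]

/-- The class of a polynomial vector field in `L²` of the ball. -/
noncomputable def fieldL2 (P : Fin n → MvPolynomial (Fin n) ℝ) : BallL2Vec n :=
  (memLp_polyField P).toLp _

theorem coeFn_polyL2 (p : MvPolynomial (Fin n) ℝ) : polyL2 p =ᵐ[uniformBall n] polyFun p :=
  (memLp_polyFun p).coeFn_toLp

theorem coeFn_fieldL2 (P : Fin n → MvPolynomial (Fin n) ℝ) :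
    fieldL2 P =ᵐ[uniformBall n] polyField P :=
  (memLp_polyField P).coeFn_toLp

/-- Polynomials belong to the Sobolev space of the ball, with their usual gradient. -/
theorem polyL2_mem_sobolevPairs (p : MvPolynomial (Fin n) ℝ) :
    (polyL2 p, fieldL2 fun i => pderiv i p) ∈ sobolevPairs n := by
  -- The bump equals one on the unit ball, so multiplying by it gives compact support and changes
  -- neither the polynomial nor its gradient there.
  let b : ContDiffBump (0 : EuclideanSpace ℝ (Fin n)) := ⟨1, 2, one_pos, one_lt_two⟩
  have hb1 : ContDiff ℝ ∞ fun x => b x * polyFun p x := b.contDiff.mul (contDiff_polyFun p)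
  have hb2 : HasCompactSupport fun x => b x * polyFun p x := b.hasCompactSupport.mul_right
  obtain ⟨hf, hG, hm⟩ := test_mem_sobolevPairs hb1 hb2
  have heq : ∀ x ∈ Metric.ball (0 : EuclideanSpace ℝ (Fin n)) 1,
      (fun x => b x * polyFun p x) =ᶠ[nhds x] polyFun p := by
    intro x hx
    filter_upwards [Metric.isOpen_ball.mem_nhds hx] with y hy
    rw [b.one_of_mem_closedBall (Metric.ball_subset_closedBall hy), one_mul]
  convert hm using 2
  · refine (MemLp.toLp_eq_toLp_iff (memLp_polyFun p) hf).2 ?_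
    filter_upwards [ae_mem_ball_uniformBall n] with x hx using (heq x hx).eq_of_nhds.symm
  · refine (MemLp.toLp_eq_toLp_iff (memLp_polyField _) hG).2 ?_
    filter_upwards [ae_mem_ball_uniformBall n] with x hx
    rw [← gradient_polyFun, gradient, gradient, (heq x hx).fderiv_eq]

end Polynomial

/-! ### The Legendre operator of the ball and Green's formula -/

/-- Smooth cutoff functions of the unit ball. -/
noncomputable def ballCutoff {n : ℕ} (k : ℝ) (x : EuclideanSpace ℝ (Fin n)) : ℝ :=
  Real.smoothTransition (k * (1 - ‖x‖ ^ 2) - 1)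

/-! ### Supports and derivative bounds of the cutoffs. -/

section Cutoff

variable {n : ℕ}

theorem contDiff_ballCutoff (k : ℝ) :
    ContDiff ℝ ∞ (ballCutoff k : EuclideanSpace ℝ (Fin n) → ℝ) :=
  Real.smoothTransition.contDiff.comp
    ((contDiff_const.mul (contDiff_const.sub (contDiff_norm_sq ℝ))).sub contDiff_const)

theorem tsupport_ballCutoff_subset (k : ℝ) :
    tsupport (ballCutoff k : EuclideanSpace ℝ (Fin n) → ℝ) ⊆ {x | 1 ≤ k * (1 - ‖x‖ ^ 2)} := by
  refine closure_minimal (fun x hx => ?_)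
    (isClosed_le continuous_const (by fun_prop))
  by_contra hcon
  rw [mem_ofPred_eq, not_le] at hcon
  exact hx (Real.smoothTransition.zero_of_nonpos (by linarith))

theorem tsupport_ballCutoff_subset_ball {k : ℝ} (hk : 0 < k) :
    tsupport (ballCutoff k : EuclideanSpace ℝ (Fin n) → ℝ) ⊆ Metric.ball 0 1 := by
  intro x hx
  have h : 1 ≤ k * (1 - ‖x‖ ^ 2) := tsupport_ballCutoff_subset k hx
  rw [mem_ball_zero_iff]
  by_contra hcon
  rw [not_lt] at hcon
  have : 1 ≤ ‖x‖ ^ 2 := one_le_pow₀ hcon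
  nlinarith

theorem hasCompactSupport_ballCutoff {k : ℝ} (hk : 0 < k) :
    HasCompactSupport (ballCutoff k : EuclideanSpace ℝ (Fin n) → ℝ) :=
  (isCompact_closedBall 0 1).of_isClosed_subset (isClosed_tsupport _)
    ((tsupport_ballCutoff_subset_ball hk).trans Metric.ball_subset_closedBall)

theorem hasFDerivAt_ballCutoff (k : ℝ) (x : EuclideanSpace ℝ (Fin n)) :
    HasFDerivAt (ballCutoff k)
      ((deriv Real.smoothTransition (k * (1 - ‖x‖ ^ 2) - 1) * (-2 * k)) • innerSL ℝ x) x := by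
  have h1 : HasFDerivAt (fun y : EuclideanSpace ℝ (Fin n) => k * (1 - ‖y‖ ^ 2) - 1)
      (k • -((2 : ℕ) • innerSL ℝ x)) x :=
    (((hasStrictFDerivAt_norm_sq x).hasFDerivAt.const_sub 1).const_mul k).sub_const 1
  have h2 : HasDerivAt Real.smoothTransition
      (deriv Real.smoothTransition (k * (1 - ‖x‖ ^ 2) - 1)) (k * (1 - ‖x‖ ^ 2) - 1) :=
    ((Real.smoothTransition.contDiff (n := 1)).differentiable (by simp)).differentiableAt.hasDerivAt
  refine (h2.comp_hasFDerivAt x h1).congr_fderiv ?_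
  rw [← Nat.cast_smul_eq_nsmul ℝ, smul_neg, smul_smul, ← neg_smul, smul_smul]
  congr 1
  push_cast
  ring

theorem deriv_smoothTransition_eq_zero {t : ℝ} (ht : t < 0 ∨ 1 < t) :
    deriv Real.smoothTransition t = 0 := by
  rcases ht with ht | ht
  · have : Real.smoothTransition =ᶠ[nhds t] fun _ => 0 := by
      filter_upwards [Iio_mem_nhds ht] with s hs using Real.smoothTransition.zero_of_nonpos hs.le
    rw [this.deriv_eq, deriv_const]
  · have : Real.smoothTransition =ᶠ[nhds t] fun _ => 1 := by
      filter_upwards [Ioi_mem_nhds ht] with s hs using Real.smoothTransition.one_of_one_le hs.le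
    rw [this.deriv_eq, deriv_const]

theorem continuous_deriv_smoothTransition : Continuous (deriv Real.smoothTransition) :=
  (Real.smoothTransition.contDiff (n := 1)).continuous_deriv (by simp)

/-- The derivative at `t - 1` vanishes for `t` outside `[1, 2]`. With `t = k(1 - ‖x‖²)` the bound is
uniform in `k` and serves as domination in Green's formula. -/
theorem exists_bound_mul_deriv_smoothTransition :
    ∃ C, ∀ t : ℝ, |t * deriv Real.smoothTransition (t - 1)| ≤ C := by
  have hc : Continuous fun t : ℝ => t * deriv Real.smoothTransition (t - 1) :=
    continuous_id.mul (continuous_deriv_smoothTransition.comp (continuous_id.sub continuous_const))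
  obtain ⟨C, hC⟩ := (isCompact_Icc (a := (1 : ℝ)) (b := 2)).exists_bound_of_continuousOn
    hc.continuousOn
  refine ⟨C, fun t => ?_⟩
  by_cases ht : t ∈ Icc (1 : ℝ) 2
  · exact hC t ht
  · have h0 : deriv Real.smoothTransition (t - 1) = 0 := by
      refine deriv_smoothTransition_eq_zero ?_
      by_contra hcon
      push Not at hcon
      exact ht ⟨by linarith, by linarith⟩
    rw [h0, mul_zero, abs_zero]
    exact (norm_nonneg _).trans (hC 1 (by simp))

end Cutoff

/-! ### Algebra of the Legendre operator, Green's formula and the energy comparison. -/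

section Legendre

open MvPolynomial

variable {n : ℕ}

/-- The Euler operator `x · ∇` on polynomials. -/
noncomputable def eulerOp : MvPolynomial (Fin n) ℝ →ₗ[ℝ] MvPolynomial (Fin n) ℝ :=
  ∑ i, LinearMap.mulLeft ℝ (X i) ∘ₗ (pderiv (R := ℝ) i).toLinearMap

/-- The Laplace operator on polynomials. -/
noncomputable def laplaceOp : MvPolynomial (Fin n) ℝ →ₗ[ℝ] MvPolynomial (Fin n) ℝ :=
  ∑ i, (pderiv (R := ℝ) i).toLinearMap ∘ₗ (pderiv (R := ℝ) i).toLinearMap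

/-- The Legendre operator `-div ((1 - x xᵀ) ∇)` on polynomials. -/
noncomputable def legendreOp : MvPolynomial (Fin n) ℝ →ₗ[ℝ] MvPolynomial (Fin n) ℝ :=
  eulerOp ∘ₗ eulerOp + (n : ℝ) • eulerOp - laplaceOp

/-- The vector field `(1 - x xᵀ) ∇p`. -/
noncomputable def legendreField (p : MvPolynomial (Fin n) ℝ) (i : Fin n) :
    MvPolynomial (Fin n) ℝ :=
  pderiv i p - X i * eulerOp p

theorem eulerOp_apply (p : MvPolynomial (Fin n) ℝ) : eulerOp p = ∑ i, X i * pderiv i p := by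
  simp [eulerOp]

theorem laplaceOp_apply (p : MvPolynomial (Fin n) ℝ) :
    laplaceOp p = ∑ i, pderiv i (pderiv i p) := by
  simp [laplaceOp]

theorem legendreOp_apply (p : MvPolynomial (Fin n) ℝ) :
    legendreOp p = eulerOp (eulerOp p) + (n : ℝ) • eulerOp p - laplaceOp p := rfl

theorem sum_pderiv_legendreField (p : MvPolynomial (Fin n) ℝ) :
    ∑ i, pderiv i (legendreField p i) = -legendreOp p := by
  simp only [legendreField, map_sub, Derivation.leibniz, pderiv_X_self, smul_eq_mul, mul_one,
    Finset.sum_sub_distrib, Finset.sum_add_distrib]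
  rw [← eulerOp_apply, ← laplaceOp_apply, legendreOp_apply]
  simp only [Finset.sum_const, Finset.card_univ, Fintype.card_fin, Nat.cast_smul_eq_nsmul]
  abel

theorem polyFun_eulerOp (p : MvPolynomial (Fin n) ℝ) (x : EuclideanSpace ℝ (Fin n)) :
    polyFun (eulerOp p) x = ⟪x, polyField (fun i => pderiv i p) x⟫ := by
  rw [inner_polyField, eulerOp_apply]
  simp [polyFun]

theorem polyField_legendreField (p : MvPolynomial (Fin n) ℝ) (x : EuclideanSpace ℝ (Fin n)) :
    polyField (legendreField p) x =
      polyField (fun i => pderiv i p) x - polyFun (eulerOp p) x • x := by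
  ext i
  simp [legendreField, polyFun, mul_comm]

/-- The factor `1 - ‖x‖²` is the degeneracy at the sphere; it compensates the factor `k` in the
gradient of the cutoff. -/
theorem inner_self_polyField_legendreField (p : MvPolynomial (Fin n) ℝ)
    (x : EuclideanSpace ℝ (Fin n)) :
    ⟪x, polyField (legendreField p) x⟫ = (1 - ‖x‖ ^ 2) * polyFun (eulerOp p) x := by
  rw [polyField_legendreField, inner_sub_right, inner_smul_right, ← polyFun_eulerOp,
    real_inner_self_eq_norm_sq]
  ring

/-- The divergence of the truncated field `χ (1 - x xᵀ) ∇p`. -/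
theorem sum_fderiv_ballCutoff_mul (k : ℝ) (p : MvPolynomial (Fin n) ℝ)
    (x : EuclideanSpace ℝ (Fin n)) :
    ∑ i, fderiv ℝ (fun y => ballCutoff k y * polyFun (legendreField p i) y) x
        (EuclideanSpace.single i 1) =
      -(ballCutoff k x * polyFun (legendreOp p) x + 2 * (k * (1 - ‖x‖ ^ 2) *
        deriv Real.smoothTransition (k * (1 - ‖x‖ ^ 2) - 1)) * polyFun (eulerOp p) x) := by
  set d := deriv Real.smoothTransition (k * (1 - ‖x‖ ^ 2) - 1) with hd
  have h1 : ∀ i, fderiv ℝ (fun y => ballCutoff k y * polyFun (legendreField p i) y) x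
        (EuclideanSpace.single i 1) =
      ballCutoff k x * polyFun (pderiv i (legendreField p i)) x +
        d * (-2 * k) * (x i * polyFun (legendreField p i) x) := by
    intro i
    have h := (hasFDerivAt_ballCutoff k x).mul (hasFDerivAt_polyFun (legendreField p i) x)
    change fderiv ℝ (ballCutoff k * polyFun (legendreField p i)) x _ = _
    rw [h.fderiv, _root_.add_apply]
    simp only [_root_.smul_apply, innerSL_apply_apply, smul_eq_mul, EuclideanSpace.inner_single_right]
    simp
    ring
  rw [Finset.sum_congr rfl fun i _ => h1 i, Finset.sum_add_distrib, ← Finset.mul_sum,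
    ← Finset.mul_sum, ← inner_polyField, inner_self_polyField_legendreField]
  have h2 : ∑ i, polyFun (pderiv i (legendreField p i)) x = -polyFun (legendreOp p) x := by
    have := congrArg (fun q => polyFun q x) (sum_pderiv_legendreField p)
    simpa [polyFun] using this
  rw [h2]
  ring

/-- Green's formula for the Legendre operator: no boundary term occurs. -/
theorem integral_inner_legendreField {f : BallL2 n} {G : BallL2Vec n}
    (h : (f, G) ∈ sobolevPairs n) (p : MvPolynomial (Fin n) ℝ) :
    ∫ x, ⟪G x, polyField (legendreField p) x⟫ ∂(uniformBall n) =
      ∫ x, f x * polyFun (legendreOp p) x ∂(uniformBall n) := by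
  have hfi : Integrable f (uniformBall n) := (Lp.memLp f).integrable one_le_two
  have hGi : Integrable G (uniformBall n) := (Lp.memLp G).integrable one_le_two
  have hb := ae_mem_ball_uniformBall n
  -- Test the weak gradient with each component of the truncated field in its own coordinate
  -- direction, and sum.
  have hstep : ∀ k : ℝ, 0 < k →
      ∫ x, ballCutoff k x * ⟪G x, polyField (legendreField p) x⟫ ∂(uniformBall n) =
      ∫ x, f x * (ballCutoff k x * polyFun (legendreOp p) x + 2 * (k * (1 - ‖x‖ ^ 2) *
        deriv Real.smoothTransition (k * (1 - ‖x‖ ^ 2) - 1)) * polyFun (eulerOp p) x)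
        ∂(uniformBall n) := by
    intro k hk
    have hφ1 : ∀ i, ContDiff ℝ ∞ fun y => ballCutoff k y * polyFun (legendreField p i) y :=
      fun i => (contDiff_ballCutoff k).mul (contDiff_polyFun _)
    have hφ2 : ∀ i, HasCompactSupport fun y => ballCutoff k y * polyFun (legendreField p i) y :=
      fun i => (hasCompactSupport_ballCutoff hk).mul_right
    have hi := fun i => h _ (hφ1 i) (hφ2 i)
      ((tsupport_mul_subset_left).trans (tsupport_ballCutoff_subset_ball hk))
      (EuclideanSpace.single i 1)
    have hs := Finset.sum_congr (rfl : (Finset.univ : Finset (Fin n)) = _) fun i _ => hi i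
    rw [← integral_finsetSum, Finset.sum_neg_distrib, ← integral_finsetSum] at hs
    · simp only [← Finset.mul_sum, sum_fderiv_ballCutoff_mul, mul_neg] at hs
      rw [integral_neg, neg_inj] at hs
      rw [hs]
      refine integral_congr_ae (Eventually.of_forall fun x => ?_)
      simp only
      rw [inner_polyField, Finset.mul_sum]
      refine Finset.sum_congr rfl fun i _ => ?_
      rw [EuclideanSpace.inner_single_right]
      simp
      ring
    · exact fun i _ => integrable_mul_test (memLp_inner_const (Lp.memLp G) _) (hφ1 i).continuous
        (hφ2 i)
    · exact fun i _ => integrable_mul_test (Lp.memLp f)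
        (((hφ1 i).continuous_fderiv (by simp)).clm_apply continuous_const)
        ((hφ2 i).fderiv_apply ℝ _)
  -- Beyond the threshold `2` the cutoff is one and its derivative zero; `k + 1` keeps the parameter
  -- positive at `k = 0`.
  have hchi : ∀ x ∈ Metric.ball (0 : EuclideanSpace ℝ (Fin n)) 1,
      ∀ᶠ k : ℕ in atTop, 2 < ((k : ℝ) + 1) * (1 - ‖x‖ ^ 2) := by
    intro x hx
    rw [mem_ball_zero_iff] at hx
    have hpos : 0 < 1 - ‖x‖ ^ 2 := by nlinarith [norm_nonneg x]
    have : Tendsto (fun k : ℕ => ((k : ℝ) + 1) * (1 - ‖x‖ ^ 2)) atTop atTop :=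
      (tendsto_natCast_atTop_atTop.atTop_add tendsto_const_nhds).atTop_mul_const hpos
    exact this.eventually_gt_atTop 2
  have hle : ∀ (k : ℝ) (x : EuclideanSpace ℝ (Fin n)), |ballCutoff k x| ≤ 1 := fun k x => by
    rw [ballCutoff, abs_of_nonneg (Real.smoothTransition.nonneg _)]
    exact Real.smoothTransition.le_one _
  have hcm : ∀ k : ℝ, Continuous (ballCutoff k : EuclideanSpace ℝ (Fin n) → ℝ) := fun k =>
    (contDiff_ballCutoff k).continuous
  obtain ⟨C, hC⟩ := exists_bound_mul_deriv_smoothTransition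
  obtain ⟨C1, hC1⟩ := exists_bound_ball_of_continuous (continuous_polyFun (legendreOp p))
  obtain ⟨C2, hC2⟩ := exists_bound_ball_of_continuous (continuous_polyFun (eulerOp p))
  obtain ⟨C3, hC3⟩ := exists_bound_ball_of_continuous (continuous_polyField (legendreField p))
  have hL : Tendsto (fun k : ℕ => ∫ x, ballCutoff ((k : ℝ) + 1) x *
      ⟪G x, polyField (legendreField p) x⟫ ∂(uniformBall n)) atTop
      (nhds (∫ x, ⟪G x, polyField (legendreField p) x⟫ ∂(uniformBall n))) := by
    refine tendsto_integral_of_dominated_convergence (fun x => ‖G x‖ * C3) (fun k => ?_)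
      (hGi.norm.mul_const _) (fun k => ?_) ?_
    · exact (hcm _).aestronglyMeasurable.mul
        (hGi.aestronglyMeasurable.inner (continuous_polyField _).aestronglyMeasurable)
    · filter_upwards [hb] with x hx
      rw [norm_mul]
      calc _ ≤ 1 * (‖G x‖ * ‖polyField (legendreField p) x‖) :=
            mul_le_mul (hle _ _) (norm_inner_le_norm _ _) (norm_nonneg _) zero_le_one
        _ ≤ _ := by
            rw [one_mul]; exact mul_le_mul_of_nonneg_left (hC3 x hx) (norm_nonneg _)
    · filter_upwards [hb] with x hx
      refine tendsto_const_nhds.congr' ?_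
      filter_upwards [hchi x hx] with k hk
      rw [ballCutoff, Real.smoothTransition.one_of_one_le (by linarith), one_mul]
  have hR : Tendsto (fun k : ℕ => ∫ x, f x * (ballCutoff ((k : ℝ) + 1) x *
        polyFun (legendreOp p) x + 2 * (((k : ℝ) + 1) * (1 - ‖x‖ ^ 2) *
        deriv Real.smoothTransition (((k : ℝ) + 1) * (1 - ‖x‖ ^ 2) - 1)) * polyFun (eulerOp p) x)
        ∂(uniformBall n)) atTop
      (nhds (∫ x, f x * polyFun (legendreOp p) x ∂(uniformBall n))) := by
    refine tendsto_integral_of_dominated_convergence (fun x => ‖f x‖ * (1 * C1 + 2 * C * C2))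
      (fun k => ?_) (hfi.norm.mul_const _) (fun k => ?_) ?_
    · refine hfi.aestronglyMeasurable.mul (Continuous.aestronglyMeasurable ?_)
      have hd := continuous_deriv_smoothTransition.comp (show Continuous
        fun x : EuclideanSpace ℝ (Fin n) => ((k : ℝ) + 1) * (1 - ‖x‖ ^ 2) - 1 by fun_prop)
      have hq : Continuous fun x : EuclideanSpace ℝ (Fin n) => ((k : ℝ) + 1) * (1 - ‖x‖ ^ 2) := by
        fun_prop
      exact ((hcm _).mul (continuous_polyFun _)).add
        ((continuous_const.mul (hq.mul hd)).mul (continuous_polyFun _))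
    · filter_upwards [hb] with x hx
      rw [norm_mul]
      refine mul_le_mul_of_nonneg_left ((norm_add_le _ _).trans (add_le_add ?_ ?_)) (norm_nonneg _)
      · rw [norm_mul]
        exact mul_le_mul (hle _ _) (hC1 x hx) (norm_nonneg _) zero_le_one
      · rw [norm_mul, norm_mul, Real.norm_two]
        exact mul_le_mul (mul_le_mul_of_nonneg_left (hC _) zero_le_two) (hC2 x hx) (norm_nonneg _)
          (mul_nonneg zero_le_two ((abs_nonneg _).trans (hC 0)))
    · filter_upwards [hb] with x hx
      refine tendsto_const_nhds.congr' ?_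
      filter_upwards [hchi x hx] with k hk
      rw [ballCutoff, Real.smoothTransition.one_of_one_le (by linarith),
        deriv_smoothTransition_eq_zero (Or.inr (by linarith))]
      ring
  exact tendsto_nhds_unique hL (hR.congr fun k => (hstep _ (by positivity)).symm)

/-- Green's formula in terms of `L²` inner products. -/
theorem inner_fieldL2_legendreField {f : BallL2 n} {G : BallL2Vec n}
    (h : (f, G) ∈ sobolevPairs n) (p : MvPolynomial (Fin n) ℝ) :
    ⟪G, fieldL2 (legendreField p)⟫ = ⟪f, polyL2 (legendreOp p)⟫ := by
  have h1 : ⟪G, fieldL2 (legendreField p)⟫ =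
      ∫ x, ⟪G x, polyField (legendreField p) x⟫ ∂(uniformBall n) := by
    rw [L2.inner_def]
    refine integral_congr_ae ?_
    filter_upwards [coeFn_fieldL2 (legendreField p)] with x hx
    rw [hx]
  have h2 : ⟪f, polyL2 (legendreOp p)⟫ =
      ∫ x, f x * polyFun (legendreOp p) x ∂(uniformBall n) := by
    rw [L2.inner_def]
    refine integral_congr_ae ?_
    filter_upwards [coeFn_polyL2 (legendreOp p)] with x hx
    rw [hx]
    simp [mul_comm]
  rw [h1, h2, integral_inner_legendreField h]

/-- The Legendre operator is symmetric. -/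
theorem inner_legendreOp_comm (p q : MvPolynomial (Fin n) ℝ) :
    ⟪polyL2 p, polyL2 (legendreOp q)⟫ = ⟪polyL2 (legendreOp p), polyL2 q⟫ := by
  -- Green's formula on both sides reduces symmetry to that of the matrix `1 - x xᵀ`.
  rw [← inner_fieldL2_legendreField (polyL2_mem_sobolevPairs p), real_inner_comm (polyL2 q),
    ← inner_fieldL2_legendreField (polyL2_mem_sobolevPairs q), L2.inner_def, L2.inner_def]
  refine integral_congr_ae ?_
  filter_upwards [coeFn_fieldL2 (legendreField p), coeFn_fieldL2 (legendreField q),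
    coeFn_fieldL2 fun i => pderiv i p, coeFn_fieldL2 fun i => pderiv i q] with x h1 h2 h3 h4
  rw [h1, h2, h3, h4, polyField_legendreField, polyField_legendreField, inner_sub_right,
    inner_sub_right, inner_smul_right, inner_smul_right, real_inner_comm x, real_inner_comm x,
    ← polyFun_eulerOp, ← polyFun_eulerOp,
    real_inner_comm (polyField (fun i => pderiv i p) x)]
  ring

/-- This is positivity of `1 - x xᵀ` in the ball. -/
theorem sq_inner_le_sq_norm {x : EuclideanSpace ℝ (Fin n)} (hx : ‖x‖ < 1)
    (v : EuclideanSpace ℝ (Fin n)) : ⟪x, v⟫ ^ 2 ≤ ‖v‖ ^ 2 := by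
  rw [← sq_abs ⟪x, v⟫]
  refine pow_le_pow_left₀ (abs_nonneg _) ((abs_real_inner_le_norm x v).trans ?_) 2
  exact mul_le_of_le_one_left (norm_nonneg v) hx.le

/-- The Dirichlet energy dominates the energy of the Legendre operator of polynomial
approximations. -/
theorem two_mul_inner_legendreOp_sub_le {f : BallL2 n} {G : BallL2Vec n}
    (h : (f, G) ∈ sobolevPairs n) (p : MvPolynomial (Fin n) ℝ) :
    2 * ⟪f, polyL2 (legendreOp p)⟫ - ⟪polyL2 p, polyL2 (legendreOp p)⟫ ≤ ‖G‖ ^ 2 := by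
  rw [← inner_fieldL2_legendreField h, ← inner_fieldL2_legendreField (polyL2_mem_sobolevPairs p),
    ← real_inner_self_eq_norm_sq, L2.inner_def, L2.inner_def, L2.inner_def, ← integral_const_mul,
    ← integral_sub ((L2.integrable_inner _ _).const_mul _) (L2.integrable_inner _ _)]
  refine integral_mono_ae (((L2.integrable_inner _ _).const_mul _).sub (L2.integrable_inner _ _))
    (L2.integrable_inner _ _) ?_
  filter_upwards [coeFn_fieldL2 (legendreField p), coeFn_fieldL2 fun i => pderiv i p,
    ae_mem_ball_uniformBall n] with x h1 h2 hx
  rw [mem_ball_zero_iff] at hx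
  simp only [h1, h2, polyField_legendreField, polyFun_eulerOp]
  set g := polyField (fun i => pderiv i p) x
  have h3 := sq_inner_le_sq_norm hx (G x - g)
  rw [inner_sub_right, norm_sub_sq_real, ← real_inner_self_eq_norm_sq g] at h3
  -- With `M = 1 - x xᵀ`, the pointwise claim is `2 G·Mg - g·Mg ≤ G·MG ≤ |G|²`: the first inequality
  -- is `M ≥ 0` applied to `G - g`, the second is `M ≤ 1`.
  simp only [inner_sub_right, inner_smul_right, real_inner_comm x, real_inner_self_eq_norm_sq]
  rw [real_inner_self_eq_norm_sq] at h3
  nlinarith [sq_nonneg ⟪x, G x⟫]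

end Legendre

/-! ### The spectral gap of the Legendre operator on polynomials -/

section LegendreGap

open MvPolynomial

variable {n : ℕ}

theorem restrictTotalDegree_le_comap_iff {N : ℕ} {Q : Submodule ℝ (MvPolynomial (Fin n) ℝ)}
    {T : MvPolynomial (Fin n) ℝ →ₗ[ℝ] MvPolynomial (Fin n) ℝ} :
    restrictTotalDegree (Fin n) ℝ N ≤ Q.comap T ↔
      ∀ s : Fin n →₀ ℕ, ∑ i, s i ≤ N → T (monomial s 1) ∈ Q := by
  rw [restrictTotalDegree, restrictSupport_eq_span, Submodule.span_le, image_subset_iff]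
  refine forall_congr' fun s => ?_
  simp [Finsupp.sum_fintype]

theorem monomial_mem_restrictTotalDegree {N : ℕ} {s : Fin n →₀ ℕ} (hs : ∑ i, s i ≤ N) (c : ℝ) :
    monomial s c ∈ restrictTotalDegree (Fin n) ℝ N := by
  rw [restrictTotalDegree, monomial_mem_restrictSupport]
  left
  simpa [Finsupp.sum_fintype] using hs

theorem pderiv_mem_restrictTotalDegree {N : ℕ} {p : MvPolynomial (Fin n) ℝ}
    (hp : p ∈ restrictTotalDegree (Fin n) ℝ (N + 1)) (i : Fin n) :
    pderiv i p ∈ restrictTotalDegree (Fin n) ℝ N := by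
  have : restrictTotalDegree (Fin n) ℝ (N + 1) ≤
      (restrictTotalDegree (Fin n) ℝ N).comap (pderiv (R := ℝ) i).toLinearMap := by
    rw [restrictTotalDegree_le_comap_iff]
    intro s hs
    change pderiv i (monomial s 1) ∈ _
    rw [pderiv_monomial]
    by_cases hsi : s i = 0
    · simp [hsi]
    · refine monomial_mem_restrictTotalDegree ?_ _
      have hle : Finsupp.single i 1 ≤ s := by
        rw [Finsupp.single_le_iff]; omega
      have h : s = (s - Finsupp.single i 1) + Finsupp.single i 1 := (tsub_add_cancel_of_le hle).symm
      rw [h] at hs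
      simp only [Finsupp.add_apply, Finset.sum_add_distrib] at hs
      have h1 : ∑ j, (Finsupp.single i 1 : Fin n →₀ ℕ) j = 1 := by simp [Finsupp.single_apply]
      omega
  exact this hp

theorem restrictTotalDegree_mono {M N : ℕ} (h : M ≤ N) :
    restrictTotalDegree (Fin n) ℝ M ≤ restrictTotalDegree (Fin n) ℝ N := fun p hp => by
  rw [mem_restrictTotalDegree] at *
  exact hp.trans h

theorem laplaceOp_mem_restrictTotalDegree {N : ℕ} {p : MvPolynomial (Fin n) ℝ}
    (hp : p ∈ restrictTotalDegree (Fin n) ℝ (N + 1)) :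
    laplaceOp p ∈ restrictTotalDegree (Fin n) ℝ N := by
  rw [laplaceOp_apply]
  exact Submodule.sum_mem _ fun i _ => pderiv_mem_restrictTotalDegree
    (restrictTotalDegree_mono N.le_succ (pderiv_mem_restrictTotalDegree hp i)) i

theorem eulerOp_monomial (s : Fin n →₀ ℕ) (c : ℝ) :
    eulerOp (monomial s c) = ((∑ i, s i : ℕ) : ℝ) • monomial s c := by
  rw [eulerOp_apply, Finset.sum_congr rfl fun i _ => X_mul_pderiv_monomial, ← Finset.sum_smul,
    Nat.cast_smul_eq_nsmul]

theorem legendreOp_monomial (s : Fin n →₀ ℕ) (c : ℝ) :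
    legendreOp (monomial s c) =
      (((∑ i, s i : ℕ) : ℝ) * ((∑ i, s i : ℕ) + n)) • monomial s c - laplaceOp (monomial s c) := by
  rw [legendreOp_apply, eulerOp_monomial, map_smul, eulerOp_monomial, smul_smul, smul_smul,
    ← add_smul]
  congr 2
  ring

/-- Triangularity with respect to degree: the Euler part acts on monomials of degree `d` by `d(d +
n)`, which cancels in top degree, and the Laplacian lowers degree. -/
theorem legendreOp_sub_mem {N : ℕ} {p : MvPolynomial (Fin n) ℝ}
    (hp : p ∈ restrictTotalDegree (Fin n) ℝ (N + 1)) :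
    legendreOp p - (((N + 1 : ℕ) : ℝ) * ((N + 1 : ℕ) + n)) • p ∈ restrictTotalDegree (Fin n) ℝ N := by
  have : restrictTotalDegree (Fin n) ℝ (N + 1) ≤ (restrictTotalDegree (Fin n) ℝ N).comap
      (legendreOp - (((N + 1 : ℕ) : ℝ) * ((N + 1 : ℕ) + n)) • LinearMap.id) := by
    rw [restrictTotalDegree_le_comap_iff]
    intro s hs
    rw [LinearMap.sub_apply, LinearMap.smul_apply, LinearMap.id_apply, legendreOp_monomial,
      sub_right_comm, ← sub_smul]
    refine Submodule.sub_mem _ ?_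
      (laplaceOp_mem_restrictTotalDegree (monomial_mem_restrictTotalDegree hs 1))
    rcases hs.eq_or_lt with h | h
    · rw [h, sub_self, zero_smul]
      exact Submodule.zero_mem _
    · exact Submodule.smul_mem _ _ (monomial_mem_restrictTotalDegree (Nat.le_of_lt_succ h) 1)
  exact this hp

theorem exists_eq_C_of_mem_restrictTotalDegree_zero {p : MvPolynomial (Fin n) ℝ}
    (hp : p ∈ restrictTotalDegree (Fin n) ℝ 0) : ∃ c, p = C c := by
  rw [mem_restrictTotalDegree, Nat.le_zero] at hp
  exact ⟨_, totalDegree_eq_zero_iff_eq_C.1 hp⟩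

theorem legendreOp_C (c : ℝ) : legendreOp (C c : MvPolynomial (Fin n) ℝ) = 0 := by
  simp [legendreOp_apply, eulerOp_apply, laplaceOp_apply]

theorem legendreOp_mem_restrictTotalDegree {N : ℕ} {p : MvPolynomial (Fin n) ℝ}
    (hp : p ∈ restrictTotalDegree (Fin n) ℝ N) :
    legendreOp p ∈ restrictTotalDegree (Fin n) ℝ N := by
  cases N with
  | zero =>
    obtain ⟨c, rfl⟩ := exists_eq_C_of_mem_restrictTotalDegree_zero hp
    rw [legendreOp_C]
    exact Submodule.zero_mem _
  | succ N =>
    rw [← sub_add_cancel (legendreOp p) ((((N + 1 : ℕ) : ℝ) * ((N + 1 : ℕ) + n)) • p)]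
    exact Submodule.add_mem _ (restrictTotalDegree_mono N.le_succ (legendreOp_sub_mem hp))
      (Submodule.smul_mem _ _ hp)

/-- Orthogonal projection in `L²` of the ball onto the polynomials of bounded degree. -/
theorem exists_polynomial_projection (N : ℕ) (f : BallL2 n) :
    ∃ q ∈ restrictTotalDegree (Fin n) ℝ N, ∀ r ∈ restrictTotalDegree (Fin n) ℝ N,
      ⟪polyL2 r, f - polyL2 q⟫ = 0 := by
  let W : Submodule ℝ (BallL2 n) := (restrictTotalDegree (Fin n) ℝ N).map polyL2
  obtain ⟨y, ⟨q, hq, rfl⟩, z, hz, hf⟩ := W.exists_add_mem_mem_orthogonal f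
  refine ⟨q, hq, fun r hr => ?_⟩
  rw [hf, add_sub_cancel_left]
  exact hz _ ⟨r, hr, rfl⟩

theorem norm_polyL2_one : ‖(polyL2 1 : BallL2 n)‖ = 1 := by
  have h1 : ⟪(polyL2 1 : BallL2 n), polyL2 1⟫ = 1 := by
    rw [L2.inner_def]
    have : ∫ x, ⟪(polyL2 1 : BallL2 n) x, (polyL2 1 : BallL2 n) x⟫ ∂(uniformBall n) =
        ∫ _, (1 : ℝ) ∂(uniformBall n) := by
      refine integral_congr_ae ?_
      filter_upwards [coeFn_polyL2 (1 : MvPolynomial (Fin n) ℝ)] with x hx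
      rw [hx]
      simp [polyFun]
    rw [this]
    simp
  rw [real_inner_self_eq_norm_sq] at h1
  nlinarith [norm_nonneg (polyL2 1 : BallL2 n)]

/-- Split off the part `r` of `p` orthogonal to lower degrees. Triangularity makes its energy `(N +
1)(N + 1 + n)‖r‖²`, at least `(n + 1)‖r‖²`; cross terms vanish because `L` is symmetric and
preserves degree bounds. No eigenbasis is needed. -/
theorem legendreOp_gap (N : ℕ) : ∀ p ∈ restrictTotalDegree (Fin n) ℝ N,
    ⟪(polyL2 1 : BallL2 n), polyL2 p⟫ = 0 →
      ((n : ℝ) + 1) * ‖polyL2 p‖ ^ 2 ≤ ⟪polyL2 p, polyL2 (legendreOp p)⟫ := by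
  induction N with
  | zero =>
    intro p hp h1
    obtain ⟨c, rfl⟩ := exists_eq_C_of_mem_restrictTotalDegree_zero hp
    have h2 : polyL2 (C c : MvPolynomial (Fin n) ℝ) = c • polyL2 1 := by
      rw [← map_smul, smul_eq_C_mul, mul_one]
    rw [h2, inner_smul_right, real_inner_self_eq_norm_sq, norm_polyL2_one] at h1
    have hc : c = 0 := by simpa using h1
    simp [hc]
  | succ N ih =>
    intro p hp h1
    obtain ⟨q, hq, hproj⟩ := exists_polynomial_projection N (polyL2 p)
    obtain ⟨r, rfl⟩ : ∃ r, p = q + r := ⟨p - q, by ring⟩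
    rw [map_add, add_sub_cancel_left] at hproj
    have hr : r ∈ restrictTotalDegree (Fin n) ℝ (N + 1) := by
      simpa using Submodule.sub_mem _ hp (restrictTotalDegree_mono N.le_succ hq)
    have hone : (1 : MvPolynomial (Fin n) ℝ) ∈ restrictTotalDegree (Fin n) ℝ N := by
      simp [mem_restrictTotalDegree]
    have hq1 : ⟪(polyL2 1 : BallL2 n), polyL2 q⟫ = 0 := by
      rw [map_add, inner_add_right, hproj _ hone, add_zero] at h1
      exact h1
    have hqr : ⟪polyL2 q, polyL2 r⟫ = 0 := hproj _ hq
    have hLqr : ⟪polyL2 (legendreOp q), polyL2 r⟫ = 0 :=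
      hproj _ (legendreOp_mem_restrictTotalDegree hq)
    have hrr : ⟪polyL2 r, polyL2 (legendreOp r)⟫ =
        (((N + 1 : ℕ) : ℝ) * ((N + 1 : ℕ) + n)) * ‖polyL2 r‖ ^ 2 := by
      have h := hproj _ (legendreOp_sub_mem hr)
      rw [map_sub, map_smul, inner_sub_left, real_inner_smul_left, real_inner_self_eq_norm_sq] at h
      rw [real_inner_comm]
      linarith
    have hκ : (n : ℝ) + 1 ≤ ((N + 1 : ℕ) : ℝ) * ((N + 1 : ℕ) + n) := by
      push_cast
      have : (0 : ℝ) ≤ N := N.cast_nonneg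
      have : (0 : ℝ) ≤ n := n.cast_nonneg
      nlinarith [mul_nonneg ‹(0 : ℝ) ≤ N› this]
    have hq2 := ih q hq hq1
    have hmul := mul_le_mul_of_nonneg_right hκ (sq_nonneg ‖polyL2 r‖)
    rw [map_add, map_add, map_add, norm_add_sq_real, inner_add_left, inner_add_right,
      inner_add_right, inner_legendreOp_comm q r, hLqr, hqr, hrr,
      real_inner_comm (polyL2 (legendreOp q)) (polyL2 r), hLqr]
    linarith

/-! ### Density of polynomials and the Poincaré inequality -/

theorem exists_polynomial_near_of_continuous {g : EuclideanSpace ℝ (Fin n) → ℝ}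
    (hg : Continuous g) {ε : ℝ} (hε : 0 < ε) :
    ∃ p : MvPolynomial (Fin n) ℝ,
      ∀ x ∈ Metric.ball (0 : EuclideanSpace ℝ (Fin n)) 1, |polyFun p x - g x| ≤ ε := by
  let coord : Fin n → C(EuclideanSpace ℝ (Fin n), ℝ) := fun i => ⟨fun x => x i, by fun_prop⟩
  have heval : ∀ (p : MvPolynomial (Fin n) ℝ) x, aeval coord p x = polyFun p x := by
    intro p x
    induction p using MvPolynomial.induction_on with
    | C a => simp [polyFun]
    | add p q hp hq => rw [map_add, ContinuousMap.add_apply, hp, hq]; simp [polyFun]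
    | mul_X p i hp =>
      rw [map_mul, ContinuousMap.mul_apply, hp]
      simp [polyFun, coord]
  have hsep : (aeval (R := ℝ) coord).range.SeparatesPoints := by
    intro x y hxy
    obtain ⟨i, hi⟩ : ∃ i, x i ≠ y i := by
      by_contra hcon
      push Not at hcon
      exact hxy (by ext i; exact hcon i)
    exact ⟨coord i, ⟨coord i, ⟨X i, by simp⟩, rfl⟩, hi⟩
  obtain ⟨-, ⟨p, rfl⟩, hp⟩ :=
    -- Stone–Weierstrass on the closed ball, for the algebra generated by the coordinates.
    ContinuousMap.exists_mem_subalgebra_near_continuous_of_isCompact_of_separatesPoints hsep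
      ⟨g, hg⟩ (isCompact_closedBall (0 : EuclideanSpace ℝ (Fin n)) 1) hε
  refine ⟨p, fun x hx => ?_⟩
  have := hp x (Metric.ball_subset_closedBall hx)
  rw [← heval]
  exact this.le

/-- Polynomials are dense in `L²` of the ball. -/
theorem exists_polyL2_near (f : BallL2 n) {ε : ℝ} (hε : 0 < ε) :
    ∃ p, ‖f - polyL2 p‖ ≤ ε := by
  have hε2 : ENNReal.ofReal (ε / 2) ≠ 0 := by simpa using hε
  obtain ⟨g, -, hfg, hgc, hgm⟩ :=
    (Lp.memLp f).exists_hasCompactSupport_eLpNorm_sub_le ENNReal.ofNat_ne_top hε2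
  obtain ⟨p, hp⟩ := exists_polynomial_near_of_continuous hgc (half_pos hε)
  refine ⟨p, ?_⟩
  have h1 : ‖f - hgm.toLp g‖ ≤ ε / 2 := by
    rw [Lp.norm_def]
    refine ENNReal.toReal_le_of_le_ofReal (half_pos hε).le (le_trans (le_of_eq ?_) hfg)
    refine eLpNorm_congr_ae ?_
    filter_upwards [Lp.coeFn_sub f (hgm.toLp g), hgm.coeFn_toLp] with x h1 h2
    rw [h1, Pi.sub_apply, Pi.sub_apply, h2]
  have h2 : ‖hgm.toLp g - polyL2 p‖ ≤ ε / 2 := by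
    have h3 : ∀ᵐ x ∂(uniformBall n), ‖(hgm.toLp g - polyL2 p) x‖ ≤ ε / 2 := by
      filter_upwards [Lp.coeFn_sub (hgm.toLp g) (polyL2 p), hgm.coeFn_toLp, coeFn_polyL2 p,
        ae_mem_ball_uniformBall n] with x h1 h2 h3 hx
      rw [h1, Pi.sub_apply, h2, h3, norm_sub_rev]
      exact hp x hx
    have := Lp.norm_le_of_ae_bound (half_pos hε).le h3
    simpa [measureUnivNNReal] using this
  calc ‖f - polyL2 p‖ = ‖(f - hgm.toLp g) + (hgm.toLp g - polyL2 p)‖ := by rw [sub_add_sub_cancel]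
    _ ≤ ε / 2 + ε / 2 := (norm_add_le _ _).trans (add_le_add h1 h2)
    _ = ε := add_halves ε

/-- The Poincaré inequality on the ball with constant `n + 1`. -/
theorem poincareOn_sobolevPairs : PoincareOn (sobolevPairs n) (polyL2 1) ((n : ℝ) + 1) := by
  rintro ⟨f, G⟩ hfG hmean
  simp only at hmean ⊢
  have key : ∀ ε > 0, ((n : ℝ) + 1) * ‖f‖ ^ 2 ≤ ‖G‖ ^ 2 + ((n : ℝ) + 1) * ε ^ 2 := by
    intro ε hε
    obtain ⟨p, hp⟩ := exists_polyL2_near f hε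
    have hpN : p ∈ restrictTotalDegree (Fin n) ℝ p.totalDegree :=
      (mem_restrictTotalDegree _ _ _).2 le_rfl
    -- The projection `q` approximates `f` at least as well as `p`. Unlike `p`, it inherits mean
    -- zero and satisfies `⟪f, Lq⟫ = ⟪q, Lq⟫`, so the energy comparison becomes `⟪q, Lq⟫ ≤ ‖G‖²`.
    obtain ⟨q, hq, hproj⟩ := exists_polynomial_projection p.totalDegree f
    have hone : (1 : MvPolynomial (Fin n) ℝ) ∈ restrictTotalDegree (Fin n) ℝ p.totalDegree := by
      simp [mem_restrictTotalDegree]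
    have hq1 : ⟪(polyL2 1 : BallL2 n), polyL2 q⟫ = 0 := by
      have := hproj _ hone
      rw [inner_sub_right, hmean] at this
      linarith
    have hfq : ‖f‖ ^ 2 = ‖f - polyL2 q‖ ^ 2 + ‖polyL2 q‖ ^ 2 := by
      have h := norm_add_sq_real (f - polyL2 q) (polyL2 q)
      rw [real_inner_comm, hproj _ hq, sub_add_cancel] at h
      linarith
    have hle : ‖f - polyL2 q‖ ^ 2 ≤ ε ^ 2 := by
      have h := norm_sub_sq_real (f - polyL2 q) (polyL2 (p - q))
      rw [real_inner_comm, hproj _ (Submodule.sub_mem _ hpN hq), map_sub, sub_sub_sub_cancel_right]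
        at h
      have := pow_le_pow_left₀ (norm_nonneg _) hp 2
      nlinarith [sq_nonneg ‖polyL2 p - polyL2 q‖]
    have hinner : ⟪f, polyL2 (legendreOp q)⟫ = ⟪polyL2 q, polyL2 (legendreOp q)⟫ := by
      have h := hproj _ (legendreOp_mem_restrictTotalDegree hq)
      rw [real_inner_comm, inner_sub_left] at h
      linarith
    have h1 := two_mul_inner_legendreOp_sub_le hfG q
    have h2 := legendreOp_gap _ q hq hq1
    rw [hinner] at h1
    have hn : (0 : ℝ) ≤ (n : ℝ) + 1 := by positivity
    nlinarith [mul_le_mul_of_nonneg_left hle hn]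
  have hlim : Tendsto (fun ε : ℝ => ‖G‖ ^ 2 + ((n : ℝ) + 1) * ε ^ 2) (nhdsWithin 0 (Ioi 0))
      (nhds (‖G‖ ^ 2 + ((n : ℝ) + 1) * 0 ^ 2)) :=
    (Continuous.tendsto (by fun_prop) 0).mono_left nhdsWithin_le_nhds
  have := ge_of_tendsto hlim (eventually_mem_nhdsWithin.mono fun ε hε => key ε hε)
  simpa using this

/-! ### Coordinate functions as test functions -/

theorem legendreOp_X (i : Fin n) :
    legendreOp (X i : MvPolynomial (Fin n) ℝ) = ((n : ℝ) + 1) • X i := by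
  have h1 : eulerOp (X i : MvPolynomial (Fin n) ℝ) = X i := by
    rw [eulerOp_apply]
    simp [pderiv_X, Pi.single_apply, Finset.sum_ite_eq]
  have h2 : laplaceOp (X i : MvPolynomial (Fin n) ℝ) = 0 := by
    rw [laplaceOp_apply]
    refine Finset.sum_eq_zero fun j _ => ?_
    rw [pderiv_X, Pi.single_apply]
    split_ifs <;> simp
  rw [legendreOp_apply, h1, h1, h2, add_smul, one_smul, sub_zero, add_comm]

/-- Both are eigenvectors of the symmetric operator `L`, with the distinct eigenvalues `0` and `n +
1`. -/
theorem inner_one_polyL2_X (i : Fin n) : ⟪(polyL2 1 : BallL2 n), polyL2 (X i)⟫ = 0 := by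
  have h := inner_legendreOp_comm (1 : MvPolynomial (Fin n) ℝ) (X i)
  rw [← C_1, legendreOp_C, legendreOp_X, map_zero, inner_zero_left, map_smul, inner_smul_right,
    C_1] at h
  exact (mul_eq_zero.1 h).resolve_left (by positivity)

theorem polyField_pderiv_X (i : Fin n) (x : EuclideanSpace ℝ (Fin n)) :
    polyField (fun j => pderiv j (X i)) x = EuclideanSpace.single i 1 := by
  ext j
  simp [polyFun, pderiv_X, Pi.single_apply, apply_ite, eq_comm]

theorem norm_sq_fieldL2_pderiv_X (i : Fin n) :
    ‖fieldL2 fun j => pderiv j (X i : MvPolynomial (Fin n) ℝ)‖ ^ 2 = 1 := by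
  rw [← real_inner_self_eq_norm_sq, L2.inner_def]
  have : ∫ x, ⟪(fieldL2 fun j => pderiv j (X i : MvPolynomial (Fin n) ℝ)) x,
      (fieldL2 fun j => pderiv j (X i : MvPolynomial (Fin n) ℝ)) x⟫ ∂(uniformBall n) =
      ∫ _, (1 : ℝ) ∂(uniformBall n) := by
    refine integral_congr_ae ?_
    filter_upwards [coeFn_fieldL2 fun j => pderiv j (X i : MvPolynomial (Fin n) ℝ)] with x hx
    rw [hx, polyField_pderiv_X]
    simp
  rw [this]
  simp

/-- Green's formula for `xᵢ` against itself reads `1 - ‖xᵢ‖² = (n + 1)‖xᵢ‖²`, so the second moment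
comes without polar coordinates. -/
theorem norm_sq_polyL2_X (i : Fin n) :
    ((n : ℝ) + 2) * ‖(polyL2 (X i) : BallL2 n)‖ ^ 2 = 1 := by
  have h := inner_fieldL2_legendreField (polyL2_mem_sobolevPairs (X i)) (X i)
  rw [legendreOp_X, map_smul, inner_smul_right, real_inner_self_eq_norm_sq] at h
  have h2 : ⟪fieldL2 fun j => pderiv j (X i : MvPolynomial (Fin n) ℝ),
      fieldL2 (legendreField (X i))⟫ =
      ⟪fieldL2 fun j => pderiv j (X i : MvPolynomial (Fin n) ℝ),
        fieldL2 fun j => pderiv j (X i : MvPolynomial (Fin n) ℝ)⟫ -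
      ⟪(polyL2 (X i) : BallL2 n), polyL2 (X i)⟫ := by
    rw [L2.inner_def, L2.inner_def, L2.inner_def,
      ← integral_sub (L2.integrable_inner _ _) (L2.integrable_inner _ _)]
    refine integral_congr_ae ?_
    filter_upwards [coeFn_fieldL2 fun j => pderiv j (X i : MvPolynomial (Fin n) ℝ),
      coeFn_fieldL2 (legendreField (X i)), coeFn_polyL2 (X i)] with x h1 h2 h3
    rw [h1, h2, h3, polyField_legendreField, polyFun_eulerOp, polyField_pderiv_X,
      inner_sub_right, inner_smul_right]
    simp [polyFun, EuclideanSpace.inner_single_left, EuclideanSpace.inner_single_right, sq]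
  rw [h2, real_inner_self_eq_norm_sq, norm_sq_fieldL2_pderiv_X, real_inner_self_eq_norm_sq] at h
  linarith

end LegendreGap

/-! ### The spectral gap of the ball -/

theorem isFormOperator_neumannLaplacian (n : ℕ) :
    IsFormOperator (sobolevPairs n) (neumannLaplacian n) :=
  mem_graph_neumannLaplacian n

theorem neumannLaplacian_gap {n : ℕ} (hn : 0 < n) :
    IsGreatest (gapSet (neumannLaplacian n)) (spectralGap (neumannLaplacian n)) ∧
      (n : ℝ) + 1 ≤ spectralGap (neumannLaplacian n) ∧
      spectralGap (neumannLaplacian n) ≤ (n : ℝ) + 2 := by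
  have hone : (polyL2 1, (0 : BallL2Vec n)) ∈ sobolevPairs n := by
    have h := polyL2_mem_sobolevPairs (1 : MvPolynomial (Fin n) ℝ)
    convert h using 2
    rw [eq_comm, Lp.eq_zero_iff_ae_eq_zero]
    filter_upwards [coeFn_fieldL2 fun j => MvPolynomial.pderiv j (1 : MvPolynomial (Fin n) ℝ)]
      with x hx
    rw [hx]
    ext j
    simp [polyFun]
  have hX := norm_sq_polyL2_X (⟨0, hn⟩ : Fin n)
  have hX0 : (polyL2 (MvPolynomial.X ⟨0, hn⟩) : BallL2 n) ≠ 0 := by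
    intro h
    simp [h] at hX
  obtain ⟨h1, h2, h3⟩ := (isFormOperator_neumannLaplacian n).isGreatest_gapSet
    (isClosed_sobolevPairs n) norm_polyL2_one hone (by positivity) poincareOn_sobolevPairs
    (polyL2_mem_sobolevPairs (MvPolynomial.X ⟨0, hn⟩)) (inner_one_polyL2_X _) hX0
  refine ⟨h1, h2, ?_⟩
  -- The squared gradient norm `1` is rewritten as `(n + 2)‖xᵢ‖²`, so that `‖xᵢ‖²` cancels.
  simp only [norm_sq_fieldL2_pderiv_X, ← hX] at h3
  exact le_of_mul_le_mul_right h3 (by positivity)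

theorem corollary5 :
    (∀ n : ℕ, 2 ≤ n →
      IsGreatest (gapSet (neumannLaplacian n)) (spectralGap (neumannLaplacian n)) ∧
      ((n : ℝ) - 1) * ((n : ℝ) + 2) / (n : ℝ) ≤ spectralGap (neumannLaplacian n) ∧
      spectralGap (neumannLaplacian n) ≤ (n : ℝ) + 2) ∧
    (fun n : ℕ => spectralGap (neumannLaplacian n)) =Θ[atTop] (fun n : ℕ => (n : ℝ)) ∧
    (fun n : ℕ => spectralGap (neumannLaplacian n)) ~[atTop] (fun n : ℕ => (n : ℝ)) := by
  have hequiv : (fun n : ℕ => spectralGap (neumannLaplacian n)) ~[atTop]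
      (fun n : ℕ => (n : ℝ)) := by
    rw [isEquivalent_iff_tendsto_one ((eventually_ne_atTop 0).mono fun n hn =>
      Nat.cast_ne_zero.2 hn)]
    have h2 : Tendsto (fun n : ℕ => 1 + 2 / (n : ℝ)) atTop (nhds 1) := by
      simpa using (tendsto_const_div_atTop_nhds_zero_nat (2 : ℝ)).const_add 1
    -- The sharper lower bound `n + 1` lets the constant `1` serve as the lower barrier.
    refine tendsto_of_tendsto_of_tendsto_of_le_of_le' tendsto_const_nhds h2 ?_ ?_
    · filter_upwards [eventually_gt_atTop 0] with n hn
      have hn' : (0 : ℝ) < n := Nat.cast_pos.2 hn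
      rw [Pi.div_apply, le_div_iff₀ hn']
      linarith [(neumannLaplacian_gap hn).2.1]
    · filter_upwards [eventually_gt_atTop 0] with n hn
      have hn' : (0 : ℝ) < n := Nat.cast_pos.2 hn
      rw [Pi.div_apply, div_le_iff₀ hn', add_mul, div_mul_cancel₀ _ hn'.ne', one_mul]
      exact (neumannLaplacian_gap hn).2.2
  refine ⟨fun n hn => ?_, hequiv.isTheta, hequiv⟩
  obtain ⟨h1, h2, h3⟩ := neumannLaplacian_gap (show 0 < n by omega)
  -- The stated bound is weaker than `n + 1` by exactly `2/n`.
  refine ⟨h1, le_trans ?_ h2, h3⟩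
  have hn' : (0 : ℝ) < n := by positivity
  rw [div_le_iff₀ hn']
  nlinarith
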